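/- Let $\mathbb K=\mathbb R$ or $\mathbb C$, let $T>0$ and $I=[0,T]$, and put $H=L^2((0,\tfrac12);\mathbb K)$ and $V=L^2((0,\tfrac12),w(x)\,dx;\mathbb K)$ with $w(x)=(x|\log x|)^{-3/2}$. Then $V$ is continuously and densely embedded in $H$, and by identifying $h\in H$ with $(h\,|\,\cdot)_H$ one obtains the Gelfand triple $V\hookrightarrow H\hookrightarrow V'$, where $V'$ is the space of bounded antilinear functionals on $V$. A non-autonomous form is a map $\mathfrak a:[0,T]\times V\times V\to\mathbb K$ such that $\mathfrak a(t,\cdot,\cdot)$ is sesquilinear for each $t$, $\mathfrak a(\cdot,v,w)$ is measurable for all $v,w\in V$, and $|\mathfrak a(t,v,w)|\le M\|v\|_V\|w\|_V$ for some $M\ge 0$ and all $t,v,w$. It is coercive if $\operatorname{Re}\mathfrak a(t,v,v)\ge\alpha\|v\|_V^2$ for some $\alpha>0$ and all $t,v$, and symmetric if $\mathfrak a(t,v,w)=\overline{\mathfrak a(t,w,v)}$ for all $t,v,w$. Its operator is $\mathcal A(t)\in\mathcal L(V,V')$, $\mathcal A(t)v=\mathfrak a(t,v,\cdot)$. A coercive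 form satisfies maximal regularity in $H$ if for every $f\in L^2(0,T;H)$ the solution $u\in L^2(0,T;V)\cap H^1(0,T;V')$ of $u'(t)+\mathcal A(t)u(t)=f(t)$ for a.e. $t$, $u(0)=0$, belongs to $H^1(0,T;H)$. For $s\in(0,1)$ and $p,q\in[1,\infty]$, one writes $\mathcal A\in\mathring B^{s,p}_q(I;\mathcal L(V,V'))$ if $\mathcal A$ is strongly measurable and $$\biggl(\int_0^\infty\biggl(\frac1{h^{s}}\Bigl(\int_{I_h}\|\mathcal A(t+h)-\mathcal A(t)\|_{\mathcal L(V,V')}^p\,dt\Bigr)^{1/p}\biggr)^q\frac{dh}{h}\biggr)^{1/q}<\infty,\qquad I_h=\{t\in I: t+h\in I\},$$ with the usual modifications (essential suprema) if $p=\infty$ or $q=\infty$. **Proposition.** For all $p\in[1,\infty]$ and $q\in(2,\infty]$ there exists a coercive, symmetric, non-autonomous form $\mathfrak a:[0,T]\times V\times V\to\mathbb K$ with $\mathcal A\in\mathring B^{1/2,p}_q(I;\mathcal L(V,V'))$ that does not satisfy maximal regularity in $H$. -/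

import Mathlib

open MeasureTheory Set
open scoped ENNReal ContDiff

noncomputable section

/-! ### Gelfand triple -/

/-- The antidual `V'`: bounded conjugate-linear functionals on `V`
(for real scalars this is the usual dual), with the operator norm. -/
abbrev Antidual (𝕜 V : Type*) [RCLike 𝕜] [NormedAddCommGroup V] [NormedSpace 𝕜 V] : Type _ :=
  V →L⋆[𝕜] 𝕜

/-- The map `j : V → H` realises `V` as a continuously and densely embedded subspace of `H`. -/
structure IsGelfandEmbedding {𝕜 V H : Type*} [RCLike 𝕜]
    [NormedAddCommGroup V] [InnerProductSpace 𝕜 V]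
    [NormedAddCommGroup H] [InnerProductSpace 𝕜 H] (j : V →L[𝕜] H) : Prop where
  injective : Function.Injective j
  denseRange : DenseRange j

/-- The embedding `H → V'`, which sends `h` to the functional `v ↦ (h | j v)_H`.
Mathlib's inner product is conjugate-linear in its first argument, so `(h | j v)_H`, linear in `h`
and conjugate-linear in `v`, is written `inner 𝕜 (j v) h`. -/
def pivot {𝕜 V H : Type*} [RCLike 𝕜]
    [NormedAddCommGroup V] [InnerProductSpace 𝕜 V]
    [NormedAddCommGroup H] [InnerProductSpace 𝕜 H] (j : V →L[𝕜] H) (h : H) : Antidual 𝕜 V :=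
  ((innerSL 𝕜).flip h).comp j

theorem pivot_apply {𝕜 V H : Type*} [RCLike 𝕜]
    [NormedAddCommGroup V] [InnerProductSpace 𝕜 V]
    [NormedAddCommGroup H] [InnerProductSpace 𝕜 H] (j : V →L[𝕜] H) (h : H) (v : V) :
    pivot j h v = inner 𝕜 (j v) h := rfl

/-! ### Non-autonomous forms

A continuous sesquilinear form on `V` (linear in the first, conjugate-linear in the second
argument) is the same thing as an element of `L(V, V')`, namely the operator `v ↦ a(v, ·)`.
A non-autonomous form on `[0, T]` is therefore a function `𝒜 : ℝ → L(V, V')`, of which only the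
values on `[0, T]` matter; `𝒜 t v w` is the value `a(t, v, w)` of the form, and `𝒜 t` is the
operator associated with the form at time `t`. -/

/-- Measurability of `a(·, v, w)` on `[0, T]` and uniform boundedness. -/
structure IsNonautonomousForm {𝕜 V : Type*} [RCLike 𝕜]
    [NormedAddCommGroup V] [InnerProductSpace 𝕜 V]
    (T : ℝ) (𝒜 : ℝ → V →L[𝕜] Antidual 𝕜 V) : Prop where
  measurable : ∀ v w : V, Measurable fun t : Icc (0 : ℝ) T => 𝒜 t v w
  bounded : ∃ M : ℝ, 0 ≤ M ∧ ∀ t ∈ Icc (0 : ℝ) T, ∀ v w : V, ‖𝒜 t v w‖ ≤ M * ‖v‖ * ‖w‖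

/-- Coercivity, uniformly in `t ∈ [0, T]`. -/
def IsCoerciveForm {𝕜 V : Type*} [RCLike 𝕜]
    [NormedAddCommGroup V] [InnerProductSpace 𝕜 V]
    (T : ℝ) (𝒜 : ℝ → V →L[𝕜] Antidual 𝕜 V) : Prop :=
  ∃ α : ℝ, 0 < α ∧ ∀ t ∈ Icc (0 : ℝ) T, ∀ v : V, α * ‖v‖ ^ 2 ≤ RCLike.re (𝒜 t v v)

/-- Symmetry: `a(t, v, w)` is the complex conjugate of `a(t, w, v)`. -/
def IsSymmetricForm {𝕜 V : Type*} [RCLike 𝕜]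
    [NormedAddCommGroup V] [InnerProductSpace 𝕜 V]
    (T : ℝ) (𝒜 : ℝ → V →L[𝕜] Antidual 𝕜 V) : Prop :=
  ∀ t ∈ Icc (0 : ℝ) T, ∀ v w : V, 𝒜 t v w = starRingEnd 𝕜 (𝒜 t w v)

/-! ### Homogeneous Besov spaces on `[0, T]` -/

/-- The Besov seminorm
`(∫_0^∞ (h^(-s) (∫_{I_h} ‖F(t+h) - F(t)‖^p dt)^(1/p))^q dh/h)^(1/q)` on `I = [0, T]`, where
`I_h = {t ∈ I : t + h ∈ I}`, as an extended non-negative number. For `p = ∞` or `q = ∞` the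
corresponding integral norm is the essential supremum. -/
def besovSeminorm {E : Type*} [NormedAddCommGroup E]
    (T s : ℝ) (p q : ℝ≥0∞) (F : ℝ → E) : ℝ≥0∞ :=
  eLpNorm
    (fun h : ℝ => ENNReal.ofReal (h ^ (-s)) *
      eLpNorm (fun t : ℝ => F (t + h) - F t) p
        (volume.restrict {t : ℝ | t ∈ Icc (0 : ℝ) T ∧ t + h ∈ Icc (0 : ℝ) T}))
    q ((volume.restrict (Ioi (0 : ℝ))).withDensity fun h : ℝ => ENNReal.ofReal h⁻¹)

/-- Membership in the homogeneous Besov space on `[0, T]`: strong measurability and finiteness of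
the seminorm. -/
def MemBesov {E : Type*} [NormedAddCommGroup E]
    (T s : ℝ) (p q : ℝ≥0∞) (F : ℝ → E) : Prop :=
  AEStronglyMeasurable F (volume.restrict (Icc (0 : ℝ) T)) ∧ besovSeminorm T s p q F < ⊤

/-! ### Vector-valued Sobolev functions and maximal regularity -/

/-- `g` is the weak derivative of `u` on `(0, T)`. -/
def HasWeakDeriv {E : Type*} [NormedAddCommGroup E] [NormedSpace ℝ E] [CompleteSpace E]
    (T : ℝ) (u g : ℝ → E) : Prop :=
  ∀ φ : ℝ → ℝ, ContDiff ℝ ∞ φ → HasCompactSupport φ → tsupport φ ⊆ Ioo 0 T →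
    ∫ t in Ioo 0 T, deriv φ t • u t = -∫ t in Ioo 0 T, φ t • g t

/-- `u ∈ L^2(0, T; E)`. -/
def MemL2 {E : Type*} [NormedAddCommGroup E] (T : ℝ) (u : ℝ → E) : Prop :=
  MemLp u 2 (volume.restrict (Ioo 0 T))

/-- `u ∈ H^1(0, T; E)`. -/
def MemH1 {E : Type*} [NormedAddCommGroup E] [NormedSpace ℝ E] [CompleteSpace E]
    (T : ℝ) (u : ℝ → E) : Prop :=
  MemL2 T u ∧ ∃ g : ℝ → E, MemL2 T g ∧ HasWeakDeriv T u g

/-- `u ∈ L^2(0, T; V) ∩ H^1(0, T; V')` solves `u'(t) + 𝒜(t) u(t) = f(t)` in `V'` for almost every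
`t ∈ (0, T)`, and `u(0) = u₀`. The initial value is that of the representative of `u` in
`C([0, T]; V')`. -/
def IsSolution {𝕜 V H : Type*} [RCLike 𝕜]
    [NormedAddCommGroup V] [InnerProductSpace 𝕜 V] [CompleteSpace V]
    [NormedAddCommGroup H] [InnerProductSpace 𝕜 H] [CompleteSpace H]
    (j : V →L[𝕜] H) (T : ℝ) (𝒜 : ℝ → V →L[𝕜] Antidual 𝕜 V)
    (u₀ : H) (f : ℝ → Antidual 𝕜 V) (u : ℝ → V) : Prop :=
  MemL2 T u ∧
  (∃ u' : ℝ → Antidual 𝕜 V, MemL2 T u' ∧ HasWeakDeriv T (fun t => pivot j (j (u t))) u' ∧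
    ∀ᵐ t ∂(volume.restrict (Ioo 0 T)), u' t + 𝒜 t (u t) = f t) ∧
  ∃ U : ℝ → Antidual 𝕜 V, ContinuousOn U (Icc 0 T) ∧
    (∀ᵐ t ∂(volume.restrict (Ioo 0 T)), U t = pivot j (j (u t))) ∧ U 0 = pivot j u₀

/-- Maximal regularity in `H`: for `u₀ = 0` and every `f ∈ L^2(0, T; H)` the solution `u` (for a
coercive form there is exactly one, up to equality almost everywhere) lies in `H^1(0, T; H)`. -/
def HasMaximalRegularity {𝕜 V H : Type*} [RCLike 𝕜]
    [NormedAddCommGroup V] [InnerProductSpace 𝕜 V] [CompleteSpace V]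
    [NormedAddCommGroup H] [InnerProductSpace 𝕜 H] [NormedSpace ℝ H] [CompleteSpace H]
    (j : V →L[𝕜] H) (T : ℝ) (𝒜 : ℝ → V →L[𝕜] Antidual 𝕜 V) : Prop :=
  ∀ f : ℝ → H, MemL2 T f →
    ∀ u : ℝ → V, IsSolution j T 𝒜 0 (fun t => pivot j (f t)) u → MemH1 T (fun t => j (u t))

/-! ### The concrete spaces -/

/-- Lebesgue measure on `(0, 1/2)`. -/
def baseMeasure : Measure ℝ := volume.restrict (Ioo (0 : ℝ) (1 / 2))

/-- The weight `w(x) = (x |log x|)^(-3/2)`. -/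
def weight (x : ℝ) : ℝ := (x * |Real.log x|) ^ (-(3 / 2) : ℝ)

/-- The measure `w(x) dx` on `(0, 1/2)`. -/
def weightedMeasure : Measure ℝ := baseMeasure.withDensity fun x => ENNReal.ofReal (weight x)

/-- `H = L^2(0, 1/2)`. -/
abbrev SpaceH (𝕜 : Type) [RCLike 𝕜] : Type := Lp 𝕜 2 baseMeasure

/-- `V = L^2((0, 1/2), w)`. -/
abbrev SpaceV (𝕜 : Type) [RCLike 𝕜] : Type := Lp 𝕜 2 weightedMeasure

end

/-! The solution is chosen first and the form is built around it. Under the Riesz map of `V` the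
embedding `H → V'` becomes the adjoint `j†`, and `j†j` is multiplication by `1/w`. Since `w` is
unbounded, there are unit vectors `eₙ` of `V` with disjoint supports on which `j†j` has size about
`4⁻ⁿ`.

Let `φ(t) = ∑ aₙ cos(L 4ⁿ t) eₙ` with `aₙ = 2⁻ⁿ/√(n+1)`, and let `v = j†h₀ + φ/16` with `‖j†h₀‖ = 1`
and `h₀` orthogonal to all `j eₙ`. In `V'` the factor `4⁻ⁿ` of `j†j` compensates the frequency, so
`(j†jφ)' = ψ` is again a bounded lacunary series with amplitudes `aₙ`. The form is the inner product
of `V` plus the symmetric rank-two term built from `j†h₀` and `b = -(φ+ψ)/16`. As `(v | j†h₀)_V =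
1`, this term maps `v` to `b` plus a multiple of `j†h₀`; then `b` cancels both `φ/16` and the
derivative `ψ/16`, and only a multiple of `h₀` remains. Hence `u = t v` solves the problem with
right-hand side in `L²(0,T;H)` (`residual_eq`, `isSolution`).

Regularity of the form: at distance `h ~ 4⁻ᵐ` the increments of `φ` and `ψ` are `O(aₘ) =
O(h^(1/2)/√(m+1))`, uniformly in `t`, so every `p` is covered and the `q`-th power of the seminorm
is controlled by `∑ (m+1)^(-q/2)`, which converges for `q > 2` (`besovSeminorm_lt_top_of_modulus`).

Irregularity of the solution: in `H` the squared `L²` norm of the derivative dominates a multiple of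
`∑ aₙ² ‖j eₙ‖² 16ⁿ ~ ∑ 1/(n+1) = ∞` (`not_memH1`). The gap between `ℓ²` and `ℓ^q` is the whole
point. -/

noncomputable section

/-! ### Sums over the amplitudes -/

/-- The amplitudes of the lacunary series. -/
def amp (n : ℕ) : ℝ := (1 / 2) ^ n / √(n + 1)

theorem amp_pos (n : ℕ) : 0 < amp n := by unfold amp; positivity

theorem amp_sq (n : ℕ) : amp n ^ 2 = 1 / (4 ^ n * ((n : ℝ) + 1)) := by
  rw [amp, div_pow, Real.sq_sqrt (by positivity), ← pow_mul, mul_comm n 2, pow_mul,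
    show (1 / 2 : ℝ) ^ 2 = 1 / 4 by norm_num, one_div_pow, div_div]

theorem amp_le (n : ℕ) : amp n ≤ (1 / 2) ^ n := by
  unfold amp
  apply div_le_self (by positivity)
  rw [Real.one_le_sqrt]
  linarith [(Nat.cast_nonneg n : (0 : ℝ) ≤ n)]

theorem summable_amp : Summable amp :=
  Summable.of_nonneg_of_le (fun n => (amp_pos n).le) amp_le summable_geometric_two

theorem tsum_amp_le : ∑' n, amp n ≤ 2 := by
  rw [← tsum_geometric_two]
  exact summable_amp.tsum_le_tsum amp_le summable_geometric_two

theorem sum_two_pow_div_sqrt_le (m : ℕ) :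
    ∑ n ∈ Finset.range m, (2 : ℝ) ^ n / √(n + 1) ≤ 3 * 2 ^ m / √(m + 1) := by
  induction m with
  | zero => simp
  | succ m ih =>
    rw [Finset.sum_range_succ]
    have h1 : 0 < √((m : ℝ) + 1) := by positivity
    have h2 : 0 < √((m : ℝ) + 1 + 1) := by positivity
    -- The constant 3 closes the induction: `3 + 1 = 4` must be at most `3 · 2 · √(m+1)/√(m+2)`.
    have h3 : √((m : ℝ) + 1 + 1) ≤ 3 / 2 * √((m : ℝ) + 1) := by
      rw [Real.sqrt_le_left (by positivity), mul_pow, Real.sq_sqrt (by positivity)]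
      linarith [(Nat.cast_nonneg m : (0 : ℝ) ≤ m)]
    have h4 : 4 * 2 ^ m / √((m : ℝ) + 1) ≤ 3 * 2 ^ (m + 1) / √(((m + 1 : ℕ) : ℝ) + 1) := by
      push_cast
      rw [div_le_div_iff₀ h1 h2, pow_succ]
      have := mul_le_mul_of_nonneg_left h3 (by positivity : (0 : ℝ) ≤ 4 * 2 ^ m)
      linarith
    calc _ ≤ 3 * 2 ^ m / √((m : ℝ) + 1) + 2 ^ m / √((m : ℝ) + 1) := by gcongr
      _ = 4 * 2 ^ m / √((m : ℝ) + 1) := by ring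
      _ ≤ _ := h4

theorem summable_amp_mul_min (m : ℕ) : Summable fun n => amp n * min 1 ((4 : ℝ) ^ n / 4 ^ m) :=
  Summable.of_nonneg_of_le (fun n => mul_nonneg (amp_pos n).le (by positivity))
    (fun n => mul_le_of_le_one_right (amp_pos n).le (min_le_left _ _)) summable_amp

/-- Both halves are dominated by the term `n = m`: below it the summands grow like `2ⁿ/√(n+1)`,
above it they decay like `2⁻ⁿ`. -/
theorem tsum_amp_mul_min_le (m : ℕ) :
    ∑' n, amp n * min 1 ((4 : ℝ) ^ n / 4 ^ m) ≤ 5 * amp m := by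
  rw [← (summable_amp_mul_min m).sum_add_tsum_nat_add m]
  have hm : 0 < √((m : ℝ) + 1) := by positivity
  have head : ∑ n ∈ Finset.range m, amp n * min 1 ((4 : ℝ) ^ n / 4 ^ m) ≤ 3 * amp m := by
    calc _ ≤ ∑ n ∈ Finset.range m, ((2 : ℝ) ^ n / √(n + 1)) / 4 ^ m := by
          gcongr with n
          refine (mul_le_mul_of_nonneg_left (min_le_right _ _) (amp_pos n).le).trans_eq ?_
          unfold amp
          have : (4 : ℝ) ^ n = 2 ^ n * 2 ^ n := by rw [← mul_pow]; norm_num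
          rw [this, one_div, inv_pow]
          field_simp
      _ = (∑ n ∈ Finset.range m, (2 : ℝ) ^ n / √(n + 1)) / 4 ^ m := by rw [Finset.sum_div]
      _ ≤ (3 * 2 ^ m / √(m + 1)) / 4 ^ m := by gcongr; exact sum_two_pow_div_sqrt_le m
      _ = 3 * amp m := by
          unfold amp
          have : (4 : ℝ) ^ m = 2 ^ m * 2 ^ m := by rw [← mul_pow]; norm_num
          rw [this, one_div, inv_pow]
          field_simp
  have tail : ∑' n, amp (n + m) * min 1 ((4 : ℝ) ^ (n + m) / 4 ^ m) ≤ 2 * amp m := by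
    have hle : ∀ n, amp (n + m) * min 1 ((4 : ℝ) ^ (n + m) / 4 ^ m) ≤ (1 / 2) ^ n * amp m := by
      intro n
      refine (mul_le_of_le_one_right (amp_pos _).le (min_le_left _ _)).trans ?_
      unfold amp
      rw [pow_add, mul_div_assoc]
      gcongr
      linarith [(Nat.cast_nonneg n : (0 : ℝ) ≤ n)]
    have hs := summable_geometric_two.mul_right (amp m)
    calc _ ≤ ∑' n : ℕ, (1 / 2 : ℝ) ^ n * amp m :=
          Summable.tsum_le_tsum hle ((summable_nat_add_iff m).2 (summable_amp_mul_min m)) hs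
      _ = 2 * amp m := by rw [tsum_mul_right, tsum_geometric_two]
  linarith

/-! ### Lacunary series: modulus of continuity and differentiation -/

section Lacunary

variable {E : Type*} [NormedAddCommGroup E] [NormedSpace ℝ E]

/-- The lacunary series `∑ aₙ θ(L 4ⁿ t) xₙ`. -/
def lacunary (L : ℝ) (θ : ℝ → ℝ) (x : ℕ → E) (t : ℝ) : E :=
  ∑' n, (amp n * θ (L * 4 ^ n * t)) • x n

theorem norm_lacunary_term_le {L : ℝ} {θ : ℝ → ℝ} {x : ℕ → E} (hθ : ∀ s, |θ s| ≤ 1)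
    (hx : ∀ n, ‖x n‖ ≤ 1) (t : ℝ) (n : ℕ) :
    ‖(amp n * θ (L * 4 ^ n * t)) • x n‖ ≤ amp n := by
  rw [norm_smul, norm_mul, Real.norm_eq_abs, Real.norm_eq_abs, abs_of_pos (amp_pos n)]
  have := hθ (L * 4 ^ n * t)
  calc _ ≤ amp n * 1 * 1 := by
        have := amp_pos n
        gcongr
        exact hx n
    _ = amp n := by ring

theorem summable_lacunary [CompleteSpace E] {L : ℝ} {θ : ℝ → ℝ} {x : ℕ → E} (hθ : ∀ s, |θ s| ≤ 1)
    (hx : ∀ n, ‖x n‖ ≤ 1) (t : ℝ) : Summable fun n => (amp n * θ (L * 4 ^ n * t)) • x n :=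
  Summable.of_norm_bounded summable_amp (norm_lacunary_term_le hθ hx t)

theorem norm_lacunary_le {L : ℝ} {θ : ℝ → ℝ} {x : ℕ → E} (hθ : ∀ s, |θ s| ≤ 1)
    (hx : ∀ n, ‖x n‖ ≤ 1) (t : ℝ) : ‖lacunary L θ x t‖ ≤ 2 :=
  (tsum_of_norm_bounded summable_amp.hasSum (norm_lacunary_term_le hθ hx t)).trans tsum_amp_le

theorem continuous_lacunary [CompleteSpace E] {L : ℝ} {θ : ℝ → ℝ} {x : ℕ → E} (hθ : ∀ s, |θ s| ≤ 1)
    (hc : Continuous θ) (hx : ∀ n, ‖x n‖ ≤ 1) : Continuous (lacunary L θ x) :=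
  continuous_tsum (fun n => by fun_prop) summable_amp
    fun n t => norm_lacunary_term_le hθ hx t n

/-- Low frequencies are estimated by the Lipschitz bound, high ones by `|θ| ≤ 1`; the constant `max
2 (L * T)` serves both. -/
theorem norm_lacunary_sub_le [CompleteSpace E] {L T : ℝ} (hL : 0 ≤ L) {θ : ℝ → ℝ} {x : ℕ → E}
    (hθ : ∀ s, |θ s| ≤ 1) (hl : ∀ s t, |θ s - θ t| ≤ |s - t|) (hx : ∀ n, ‖x n‖ ≤ 1)
    (m : ℕ) {h : ℝ} (h0 : 0 ≤ h) (hT : h ≤ T / 4 ^ m) (t : ℝ) :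
    ‖lacunary L θ x (t + h) - lacunary L θ x t‖ ≤ 5 * max 2 (L * T) * amp m := by
  unfold lacunary
  rw [← (summable_lacunary hθ hx (t + h)).tsum_sub (summable_lacunary hθ hx t)]
  have hC : 0 ≤ max 2 (L * T) := le_max_of_le_left (by norm_num)
  have key : ∀ n, ‖(amp n * θ (L * 4 ^ n * (t + h))) • x n - (amp n * θ (L * 4 ^ n * t)) • x n‖
      ≤ max 2 (L * T) * (amp n * min 1 ((4 : ℝ) ^ n / 4 ^ m)) := by
    intro n
    rw [← sub_smul, ← mul_sub, norm_smul, norm_mul, Real.norm_eq_abs, Real.norm_eq_abs,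
      abs_of_pos (amp_pos n)]
    have h1 : |θ (L * 4 ^ n * (t + h)) - θ (L * 4 ^ n * t)| ≤
        max 2 (L * T) * min 1 ((4 : ℝ) ^ n / 4 ^ m) := by
      rw [mul_min_of_nonneg _ _ hC]
      refine le_min ?_ ?_
      · have a := hθ (L * 4 ^ n * (t + h))
        have b := hθ (L * 4 ^ n * t)
        calc _ ≤ |θ (L * 4 ^ n * (t + h))| + |θ (L * 4 ^ n * t)| := abs_sub _ _
          _ ≤ 2 := by linarith
          _ ≤ _ := by rw [mul_one]; exact le_max_left _ _
      · calc _ ≤ |L * 4 ^ n * (t + h) - L * 4 ^ n * t| := hl _ _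
          _ = L * 4 ^ n * h := by
              rw [show L * 4 ^ n * (t + h) - L * 4 ^ n * t = L * 4 ^ n * h by ring]
              exact abs_of_nonneg (by positivity)
          _ ≤ L * 4 ^ n * (T / 4 ^ m) := by gcongr
          _ = L * T * (4 ^ n / 4 ^ m) := by ring
          _ ≤ _ := by gcongr; exact le_max_right _ _
    calc _ ≤ amp n * (max 2 (L * T) * min 1 ((4 : ℝ) ^ n / 4 ^ m)) * 1 := by
          have := amp_pos n
          gcongr
          exact hx n
      _ = _ := by ring
  refine (tsum_of_norm_bounded ((summable_amp_mul_min m).mul_left _).hasSum key).trans ?_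
  rw [tsum_mul_left]
  calc _ ≤ max 2 (L * T) * (5 * amp m) := by gcongr; exact tsum_amp_mul_min_le m
    _ = _ := by ring

/-- Termwise differentiation is legitimate because the `kₙ` are small enough to absorb the frequency
`L 4ⁿ`. -/
theorem hasDerivAt_lacunary_cos [CompleteSpace E] {L : ℝ} {k : ℕ → E} (hk : ∀ n, ‖k n‖ ≤ 1)
    (hk' : ∀ n, ‖(L * 4 ^ n) • k n‖ ≤ 1) (t : ℝ) :
    HasDerivAt (lacunary L Real.cos k)
      (lacunary L (fun s => -Real.sin s) (fun n => (L * 4 ^ n) • k n) t) t := by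
  have hθ : ∀ s : ℝ, |(-Real.sin s)| ≤ 1 := fun s => by rw [abs_neg]; exact Real.abs_sin_le_one s
  refine hasDerivAt_tsum (y₀ := 0) summable_amp (fun n y => ?_)
    (fun n y => norm_lacunary_term_le (θ := fun s => -Real.sin s) hθ hk' y n)
    (summable_lacunary Real.abs_cos_le_one hk 0) t
  have h1 : HasDerivAt (fun y : ℝ => L * 4 ^ n * y) (L * 4 ^ n) y := by
    simpa using (hasDerivAt_id y).const_mul (L * 4 ^ n)
  have := ((h1.cos).const_mul (amp n)).smul_const (k n)
  convert this using 1
  rw [smul_smul]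
  congr 1
  ring

end Lacunary

/-! ### From a modulus of continuity to the Besov seminorm -/

theorem besovSeminorm_lt_top_of_modulus {E : Type*} [NormedAddCommGroup E] {T : ℝ} (hT : 0 < T)
    {p q : ℝ≥0∞} (hq : 2 < q) {F : ℝ → E} {C : ℝ} (hC : 0 ≤ C)
    (hF : ∀ (m : ℕ) (h : ℝ), 0 ≤ h → h ≤ T / 4 ^ m → ∀ t, ‖F (t + h) - F t‖ ≤ C * amp m) :
    besovSeminorm T (1 / 2) p q F < ⊤ := by
  set B : ℝ → ℝ≥0∞ := fun h => ENNReal.ofReal (h ^ (-(1 / 2) : ℝ)) *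
      eLpNorm (fun t : ℝ => F (t + h) - F t) p
        (volume.restrict {t : ℝ | t ∈ Icc (0 : ℝ) T ∧ t + h ∈ Icc (0 : ℝ) T}) with hB
  set J : ℕ → Set ℝ := fun m => Ioc (T / 4 ^ (m + 1)) (T / 4 ^ m) with hJ
  -- On `J m` one has `h^(-1/2) ≤ 2^(m+1)/√T`; multiplied by `C aₘ` this is `D/√(m+1)`.
  set D : ℝ := 2 * C / √T with hD
  have hD0 : 0 ≤ D := by positivity
  -- For `p = ∞` the exponent is `0⁻¹ = 0`, so `M = 1`, as it should be.
  set M : ℝ≥0∞ := (volume (Icc (0 : ℝ) T)) ^ p.toReal⁻¹ with hM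
  have hMtop : M < ⊤ := ENNReal.rpow_lt_top_of_nonneg (by positivity) (by simp)
  have hbig : ∀ h, T < h → B h = 0 := by
    intro h hh
    have : {t : ℝ | t ∈ Icc (0 : ℝ) T ∧ t + h ∈ Icc (0 : ℝ) T} = ∅ := by
      ext t
      simp only [mem_ofPred_eq, mem_Icc, mem_empty_iff_false, iff_false]
      rintro ⟨⟨a, b⟩, c, d⟩
      linarith
    simp only [hB]
    rw [this, Measure.restrict_empty, eLpNorm_measure_zero, mul_zero]
  have hsmall : ∀ m, ∀ h ∈ J m, B h ≤ M * ENNReal.ofReal (D / √(m + 1)) := by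
    intro m h ⟨h1, h2⟩
    have h0 : 0 < h := lt_trans (by positivity) h1
    have e1 : eLpNorm (fun t : ℝ => F (t + h) - F t) p
        (volume.restrict {t : ℝ | t ∈ Icc (0 : ℝ) T ∧ t + h ∈ Icc (0 : ℝ) T})
        ≤ M * ENNReal.ofReal (C * amp m) := by
      refine (eLpNorm_le_of_ae_bound (ae_of_all _ (hF m h h0.le h2))).trans ?_
      rw [hM, Measure.restrict_apply_univ]
      gcongr
      exact fun t ht => ht.1
    have e2 : h ^ (-(1 / 2) : ℝ) ≤ 2 ^ (m + 1) / √T := by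
      rw [Real.rpow_neg h0.le, ← Real.sqrt_eq_rpow]
      have : √T / 2 ^ (m + 1) ≤ √h := by
        apply Real.le_sqrt_of_sq_le
        rw [div_pow, Real.sq_sqrt hT.le, ← pow_mul, mul_comm, pow_mul]
        norm_num
        exact h1.le
      calc (√h)⁻¹ ≤ (√T / 2 ^ (m + 1))⁻¹ := by
            exact inv_anti₀ (by positivity) this
        _ = _ := by rw [inv_div]
    calc B h ≤ ENNReal.ofReal (2 ^ (m + 1) / √T) * (M * ENNReal.ofReal (C * amp m)) :=
          mul_le_mul' (ENNReal.ofReal_le_ofReal e2) e1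
      _ = M * ENNReal.ofReal (D / √(m + 1)) := by
          rw [mul_left_comm, ← ENNReal.ofReal_mul (by positivity)]
          congr 2
          unfold amp
          rw [one_div, inv_pow, hD]
          field_simp
          ring
  have hcover : ∀ h : ℝ, 0 < h → h ≤ T → ∃ m, h ∈ J m := by
    intro h h0 hh
    obtain ⟨n, hn1, hn2⟩ := exists_nat_pow_near (x := T / h) (y := (4 : ℝ))
      (by rwa [one_le_div h0]) (by norm_num)
    refine ⟨n, ?_, ?_⟩
    · rw [div_lt_iff₀ (by positivity)]
      rwa [div_lt_iff₀ h0, mul_comm] at hn2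
    · rw [le_div_iff₀ (by positivity)]
      rwa [le_div_iff₀ h0, mul_comm] at hn1
  unfold besovSeminorm
  change eLpNorm B q _ < ⊤
  rcases eq_or_ne q ⊤ with rfl | hqt
  · rw [eLpNorm_exponent_top]
    have hle : ∀ᵐ h ∂((volume.restrict (Ioi (0 : ℝ))).withDensity fun h : ℝ => ENNReal.ofReal h⁻¹),
        ‖B h‖ₑ ≤ M * ENNReal.ofReal D := by
      apply (withDensity_absolutelyContinuous _ _).ae_le
      filter_upwards [ae_restrict_mem measurableSet_Ioi] with h h0
      rw [enorm_eq_self]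
      rcases lt_or_ge T h with hh | hh
      · rw [hbig h hh]; exact zero_le
      · obtain ⟨m, hm⟩ := hcover h h0 hh
        refine (hsmall m h hm).trans ?_
        gcongr
        apply div_le_self hD0
        rw [Real.one_le_sqrt]
        linarith [(Nat.cast_nonneg m : (0 : ℝ) ≤ m)]
    exact (eLpNormEssSup_le_of_ae_enorm_bound hle).trans_lt
      (ENNReal.mul_lt_top hMtop ENNReal.ofReal_lt_top)
  · have hr : 2 < q.toReal := by
      have := (ENNReal.toReal_lt_toReal (by norm_num) hqt).2 hq
      simpa using this
    set r := q.toReal with hrdef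
    have hr0 : 0 < r := by linarith
    rw [eLpNorm_lt_top_iff_lintegral_rpow_enorm_lt_top (by rintro rfl; simp at hq) hqt]
    simp only [enorm_eq_self, ← hrdef]
    have hdens : ∀ f : ℝ → ℝ≥0∞,
        ∫⁻ h, f h ∂((volume.restrict (Ioi (0 : ℝ))).withDensity fun h : ℝ => ENNReal.ofReal h⁻¹)
        = ∫⁻ h in Ioi (0 : ℝ), ENNReal.ofReal h⁻¹ * f h := by
      intro f
      rw [lintegral_withDensity_eq_lintegral_mul_non_measurable _ (by fun_prop)
        (ae_of_all _ fun _ => ENNReal.ofReal_lt_top)]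
      rfl
    rw [hdens]
    have hsub : Ioi (0 : ℝ) ⊆ (⋃ m, J m) ∪ Ioi T := by
      intro h h0
      rcases lt_or_ge T h with hh | hh
      · exact Or.inr hh
      · exact Or.inl (mem_iUnion.2 (hcover h h0 hh))
    have hzero : ∫⁻ h in Ioi T, ENNReal.ofReal h⁻¹ * B h ^ r = 0 := by
      rw [setLIntegral_congr_fun measurableSet_Ioi (g := fun _ => 0)]
      · simp
      · intro h hh
        simp only
        rw [hbig h hh, ENNReal.zero_rpow_of_pos hr0, mul_zero]
    -- Each `J m` has `dh/h`-mass at most 4, independently of `m`.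
    have hpiece : ∀ m, ∫⁻ h in J m, ENNReal.ofReal h⁻¹ * B h ^ r
        ≤ 4 * (M * ENNReal.ofReal D) ^ r * ENNReal.ofReal (1 / ((m : ℝ) + 1) ^ (r / 2)) := by
      intro m
      have hb : ∀ h ∈ J m, ENNReal.ofReal h⁻¹ * B h ^ r ≤
          ENNReal.ofReal (4 ^ (m + 1) / T) * (M * ENNReal.ofReal (D / √(m + 1))) ^ r := by
        intro h hh
        gcongr
        · rw [← inv_div]
          have : 0 < T / 4 ^ (m + 1) := by positivity
          gcongr
          exact hh.1.le
        · exact hsmall m h hh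
      refine (setLIntegral_mono' measurableSet_Ioc hb).trans ?_
      rw [setLIntegral_const, Real.volume_Ioc]
      have e1 : M * ENNReal.ofReal (D / √(m + 1))
          = M * ENNReal.ofReal D * ENNReal.ofReal (1 / √(m + 1)) := by
        rw [mul_assoc, ← ENNReal.ofReal_mul hD0, mul_one_div]
      have e2 : ENNReal.ofReal (1 / √(m + 1)) ^ r
          = ENNReal.ofReal (1 / ((m : ℝ) + 1) ^ (r / 2)) := by
        rw [ENNReal.ofReal_rpow_of_pos (by positivity), Real.div_rpow (by positivity)
          (by positivity), Real.one_rpow, Real.sqrt_eq_rpow, ← Real.rpow_mul (by positivity)]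
        congr 3
        ring
      rw [e1, ENNReal.mul_rpow_of_nonneg _ _ hr0.le, e2]
      have e3 : ENNReal.ofReal (4 ^ (m + 1) / T) *
          ENNReal.ofReal (T / 4 ^ m - T / 4 ^ (m + 1)) ≤ 4 := by
        rw [← ENNReal.ofReal_mul (by positivity)]
        rw [show (4 : ℝ≥0∞) = ENNReal.ofReal 4 by norm_num]
        apply ENNReal.ofReal_le_ofReal
        calc _ ≤ 4 ^ (m + 1) / T * (T / 4 ^ m) := by
              gcongr
              have : 0 < T / 4 ^ (m + 1) := by positivity
              linarith
          _ = 4 := by field_simp; ring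
      calc _ = (ENNReal.ofReal (4 ^ (m + 1) / T) *
          ENNReal.ofReal (T / 4 ^ m - T / 4 ^ (m + 1))) * (M * ENNReal.ofReal D) ^ r *
            ENNReal.ofReal (1 / ((m : ℝ) + 1) ^ (r / 2)) := by ring
        _ ≤ _ := by gcongr
    -- For finite `q`, convergence rests on `r / 2 > 1`, that is, on `q > 2`.
    have hsum : Summable fun m : ℕ => 1 / ((m : ℝ) + 1) ^ (r / 2) := by
      have := (summable_nat_add_iff 1).2
        (Real.summable_one_div_nat_rpow (p := r / 2).2 (by linarith))
      simpa using this
    calc _ ≤ ∫⁻ h in (⋃ m, J m) ∪ Ioi T, ENNReal.ofReal h⁻¹ * B h ^ r :=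
          lintegral_mono_set hsub
      _ ≤ (∫⁻ h in ⋃ m, J m, ENNReal.ofReal h⁻¹ * B h ^ r) +
          ∫⁻ h in Ioi T, ENNReal.ofReal h⁻¹ * B h ^ r := lintegral_union_le _ _ _
      _ ≤ (∑' m, ∫⁻ h in J m, ENNReal.ofReal h⁻¹ * B h ^ r) + 0 := by
          rw [hzero]
          gcongr
          exact lintegral_iUnion_le _ _
      _ ≤ ∑' m : ℕ, 4 * (M * ENNReal.ofReal D) ^ r *
            ENNReal.ofReal (1 / ((m : ℝ) + 1) ^ (r / 2)) := by
          rw [add_zero]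
          exact ENNReal.tsum_le_tsum hpiece
      _ = 4 * (M * ENNReal.ofReal D) ^ r *
            ENNReal.ofReal (∑' m : ℕ, 1 / ((m : ℝ) + 1) ^ (r / 2)) := by
          rw [ENNReal.tsum_mul_left, ENNReal.ofReal_tsum_of_nonneg (fun _ => by positivity) hsum]
      _ < ⊤ := by
          refine ENNReal.mul_lt_top (ENNReal.mul_lt_top (by norm_num) ?_) ENNReal.ofReal_lt_top
          exact ENNReal.rpow_lt_top_of_nonneg hr0.le
            (ENNReal.mul_lt_top hMtop ENNReal.ofReal_lt_top).ne

theorem memBesov_of_modulus {E : Type*} [NormedAddCommGroup E] {T : ℝ} (hT : 0 < T)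
    {p q : ℝ≥0∞} (hq : 2 < q) {F : ℝ → E} (hc : Continuous F) {C : ℝ} (hC : 0 ≤ C)
    (hF : ∀ (m : ℕ) (h : ℝ), 0 ≤ h → h ≤ T / 4 ^ m → ∀ t, ‖F (t + h) - F t‖ ≤ C * amp m) :
    MemBesov T (1 / 2) p q F :=
  ⟨hc.aestronglyMeasurable, besovSeminorm_lt_top_of_modulus hT hq hC hF⟩

/-! ### Weak derivatives of vector-valued functions -/

section WeakDerivative

variable {E F : Type*} [NormedAddCommGroup E] [NormedSpace ℝ E]
  [NormedAddCommGroup F] [NormedSpace ℝ F] {T : ℝ}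

theorem memL2_of_continuous {E : Type*} [NormedAddCommGroup E] {T : ℝ} {u : ℝ → E} (hu : Continuous u) : MemL2 T u := by
  obtain ⟨C, hC⟩ := isCompact_Icc.exists_bound_of_continuousOn (s := Icc 0 T) hu.continuousOn
  refine MemLp.of_bound hu.aestronglyMeasurable C ?_
  filter_upwards [ae_restrict_mem measurableSet_Ioo] with t ht
  exact hC t (Ioo_subset_Icc_self ht)

theorem MemL2.integrable {E : Type*} [NormedAddCommGroup E] {T : ℝ} {u : ℝ → E} (hu : MemL2 T u) :
    Integrable u (volume.restrict (Ioo 0 T)) :=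
  MemLp.integrable (by norm_num) hu

theorem integrable_smul_of_integrable {φ : ℝ → ℝ} (hφ : Continuous φ) {u : ℝ → E}
    (hu : Integrable u (volume.restrict (Ioo 0 T))) :
    Integrable (fun t => φ t • u t) (volume.restrict (Ioo 0 T)) := by
  obtain ⟨C, hC⟩ := isCompact_Icc.exists_bound_of_continuousOn (s := Icc 0 T) hφ.continuousOn
  refine hu.bdd_smul C hφ.aestronglyMeasurable ?_
  filter_upwards [ae_restrict_mem measurableSet_Ioo] with t ht
  exact hC t (Ioo_subset_Icc_self ht)

variable [CompleteSpace E] [CompleteSpace F]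

/-- Integration by parts; the boundary terms vanish because the support of `φ` avoids `0` and `T`.
-/
theorem hasWeakDeriv_of_hasDerivAt (hT : 0 ≤ T) {u u' : ℝ → E}
    (hu : ∀ t, HasDerivAt u (u' t) t) (hu' : Continuous u') : HasWeakDeriv T u u' := by
  intro φ hφ _ hsupp
  have hz : ∀ t, t ∉ Ioo 0 T → φ t = 0 := fun t ht =>
    image_eq_zero_of_notMem_tsupport fun h => ht (hsupp h)
  have hd : Continuous (deriv φ) := hφ.continuous_deriv (by simp)
  have huc : Continuous u := continuous_iff_continuousAt.2 fun t => (hu t).continuousAt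
  have key := intervalIntegral.integral_deriv_smul_eq_sub_of_hasDeriv_right (a := 0) (b := T)
    (u := φ) (v := u) (u' := deriv φ) (v' := u') hφ.continuous.continuousOn huc.continuousOn
    (fun t _ => (hφ.differentiable (by simp) t).hasDerivAt.hasDerivWithinAt)
    (fun t _ => (hu t).hasDerivWithinAt) (hd.intervalIntegrable _ _)
    (hu'.intervalIntegrable _ _)
  rw [hz T (by simp), hz 0 (by simp), zero_smul, zero_smul, sub_zero,
    intervalIntegral.integral_of_le hT, integral_Ioc_eq_integral_Ioo, integral_add
      (integrable_smul_of_integrable hd (memL2_of_continuous huc).integrable)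
      (integrable_smul_of_integrable hφ.continuous (memL2_of_continuous hu').integrable)] at key
  exact eq_neg_of_add_eq_zero_left key

theorem HasWeakDeriv.clm_comp {u g : ℝ → E} (h : HasWeakDeriv T u g) (hu : MemL2 T u)
    (hg : MemL2 T g) (l : E →L[ℝ] F) :
    HasWeakDeriv T (fun t => l (u t)) (fun t => l (g t)) := by
  intro φ hφ hc hsupp
  have hd : Continuous (deriv φ) := hφ.continuous_deriv (by simp)
  have := congrArg l (h φ hφ hc hsupp)
  rw [map_neg, ← l.integral_comp_comm (integrable_smul_of_integrable hd hu.integrable),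
    ← l.integral_comp_comm (integrable_smul_of_integrable hφ.continuous hg.integrable)] at this
  simpa only [map_smul] using this

theorem HasWeakDeriv.ae_eq {u g g' : ℝ → E} (h : HasWeakDeriv T u g) (h' : HasWeakDeriv T u g')
    (hg : MemL2 T g) (hg' : MemL2 T g') : ∀ᵐ t ∂(volume.restrict (Ioo 0 T)), g t = g' t := by
  have hint : IntegrableOn (fun t => g t - g' t) (Ioo 0 T) := hg.integrable.sub hg'.integrable
  have key := isOpen_Ioo.ae_eq_zero_of_integral_contDiff_smul_eq_zero (μ := volume)
    (U := Ioo 0 T) hint.locallyIntegrableOn (fun φ hφ hc hsupp => by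
      rw [← setIntegral_eq_integral_of_forall_compl_eq_zero (s := Ioo 0 T)]
      · simp_rw [smul_sub]
        rw [integral_sub (integrable_smul_of_integrable hφ.continuous hg.integrable)
          (integrable_smul_of_integrable hφ.continuous hg'.integrable), sub_eq_zero]
        exact neg_injective ((h φ hφ hc hsupp).symm.trans (h' φ hφ hc hsupp))
      · intro t ht
        rw [image_eq_zero_of_notMem_tsupport fun h => ht (hsupp h), zero_smul])
  rw [ae_restrict_iff' measurableSet_Ioo]
  filter_upwards [key] with t ht hmem
  exact sub_eq_zero.1 (ht hmem)

end WeakDerivative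

/-! ### Lower bound for the energy of one oscillating mode -/

theorem integral_sq_cos_sub_ge {T l : ℝ} (hT : 0 < T) (hl : 8 ≤ T * l) :
    T ^ 3 / 64 * l ^ 2 ≤
      ∫ t in Ioo 0 T, (Real.cos (l * t) - t * (l * Real.sin (l * t))) ^ 2 := by
  have hl0 : 0 < l := by
    by_contra h
    nlinarith [mul_nonneg hT.le (by linarith : 0 ≤ -l)]
  have hsin : ∫ t in (T / 2)..T, Real.sin (l * t) ^ 2
      = (T / 2 - Real.sin (2 * (l * T)) / (4 * l)) -
        ((T / 2) / 2 - Real.sin (2 * (l * (T / 2))) / (4 * l)) := by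
    refine intervalIntegral.integral_eq_sub_of_hasDerivAt
      (f := fun t => t / 2 - Real.sin (2 * (l * t)) / (4 * l)) (fun t _ => ?_)
      (Continuous.intervalIntegrable (by fun_prop) _ _)
    have h1 : HasDerivAt (fun t : ℝ => 2 * (l * t)) (2 * l) t := by
      simpa using ((hasDerivAt_id t).const_mul l).const_mul 2
    have := ((hasDerivAt_id t).div_const 2).sub (h1.sin.div_const (4 * l))
    refine HasDerivAt.congr_deriv this ?_
    rw [Real.cos_two_mul', Real.cos_sq']
    field_simp
    ring
  have hcont : Continuous fun t : ℝ => (Real.cos (l * t) - t * (l * Real.sin (l * t))) ^ 2 := by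
    fun_prop
  -- On `(T/2, T)` the sine term dominates, and `sin²` has mean `1/2` up to an error `O(1/l)`.
  have hlow : T ^ 3 / 64 * l ^ 2 ≤
      ∫ t in (T / 2)..T, (T ^ 2 / 8 * l ^ 2 * Real.sin (l * t) ^ 2 - 1) := by
    rw [intervalIntegral.integral_sub (Continuous.intervalIntegrable (by fun_prop) _ _)
      (by simp), intervalIntegral.integral_const_mul, hsin, intervalIntegral.integral_const]
    have a := Real.sin_le_one (2 * (l * T))
    have b := Real.neg_one_le_sin (2 * (l * (T / 2)))
    have a' : Real.sin (2 * (l * T)) / (4 * l) ≤ 1 / (4 * l) := by gcongr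
    have b' : -1 / (4 * l) ≤ Real.sin (2 * (l * (T / 2))) / (4 * l) := by gcongr
    have c : T / 4 - 1 / (2 * l) ≤ T / 2 - Real.sin (2 * (l * T)) / (4 * l) -
        (T / 2 / 2 - Real.sin (2 * (l * (T / 2))) / (4 * l)) := by
      have : 1 / (2 * l) = 1 / (4 * l) - -1 / (4 * l) := by field_simp; norm_num
      linarith
    have d := mul_le_mul_of_nonneg_left c (by positivity : 0 ≤ T ^ 2 / 8 * l ^ 2)
    have e : T ^ 2 / 8 * l ^ 2 * (T / 4 - 1 / (2 * l))
        = T * ((T * l) ^ 2 / 32 - (T * l) / 16) := by field_simp; ring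
    have f : T ^ 3 / 64 * l ^ 2 = T * ((T * l) ^ 2 / 64) := by ring
    rw [e] at d
    rw [f]
    have g : T * ((T * l) ^ 2 / 64) ≤ T * ((T * l) ^ 2 / 32 - (T * l) / 16) - T / 2 := by
      -- With `X = T l` this reads `(X - 8)(X + 4) ≥ 0`, whence the threshold 8.
      have : (T * l) ^ 2 / 64 ≤ (T * l) ^ 2 / 32 - (T * l) / 16 - 1 / 2 := by nlinarith
      nlinarith
    simp only [smul_eq_mul, mul_one]
    linarith
  refine hlow.trans ?_
  rw [intervalIntegral.integral_of_le (by linarith), integral_Ioc_eq_integral_Ioo]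
  calc _ ≤ ∫ t in Ioo (T / 2) T, (Real.cos (l * t) - t * (l * Real.sin (l * t))) ^ 2 := by
        refine setIntegral_mono_on ?_ ?_ measurableSet_Ioo ?_
        · exact (Continuous.integrableOn_Icc (by fun_prop)).mono_set Ioo_subset_Icc_self
        · exact hcont.integrableOn_Icc.mono_set Ioo_subset_Icc_self
        · intro t ht
          have h1 : T ^ 2 / 4 ≤ t ^ 2 := by nlinarith [ht.1]
          have h2 := Real.cos_sq_le_one (l * t)
          have h3 : (t * (l * Real.sin (l * t))) ^ 2 = t ^ 2 * (l ^ 2 * Real.sin (l * t) ^ 2) := by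
            ring
          have h4 := mul_le_mul_of_nonneg_right h1
            (by positivity : 0 ≤ l ^ 2 * Real.sin (l * t) ^ 2)
          -- The square `(2a - s)² ≥ 0` is equivalent to `(a - s)² ≥ s²/2 - a²`.
          nlinarith [sq_nonneg (2 * Real.cos (l * t) - t * (l * Real.sin (l * t)))]
    _ ≤ _ := by
        refine setIntegral_mono_set (hcont.integrableOn_Icc.mono_set Ioo_subset_Icc_self)
          (ae_of_all _ fun t => sq_nonneg _) ?_
        exact (Ioo_subset_Ioo_left (by linarith)).eventuallyLE

/-! ### Rank-two perturbations of the inner product -/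

set_option linter.unusedSectionVars false

section Abstract

variable {𝕜 V H : Type*} [RCLike 𝕜]
  [NormedAddCommGroup V] [InnerProductSpace 𝕜 V] [CompleteSpace V]
  [NormedAddCommGroup H] [InnerProductSpace 𝕜 H] [CompleteSpace H]

variable (𝕜 V) in
/-- The Riesz map `V → V'`. -/
def riesz : V →L[𝕜] Antidual 𝕜 V := (innerSL 𝕜).flip

theorem riesz_apply (x y : V) : riesz 𝕜 V x y = inner 𝕜 y x := rfl

/-- This moves the equation from `V'` to `V`, where the embedding of `H` acts as `j†`. -/
theorem pivot_eq_riesz (j : V →L[𝕜] H) (h : H) :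
    pivot j h = riesz 𝕜 V (ContinuousLinearMap.adjoint j h) := by
  ext y
  rw [pivot_apply, riesz_apply, ContinuousLinearMap.adjoint_inner_right]

/-- The operator of the form `(x | y) + (x | e) (b | y) + (x | b) (e | y)`. -/
def rankTwoForm (e b : V) : V →L[𝕜] Antidual 𝕜 V :=
  riesz 𝕜 V ∘L (ContinuousLinearMap.id 𝕜 V + (innerSL 𝕜 e).smulRight b
    + (innerSL 𝕜 b).smulRight e)

theorem rankTwoForm_eq_riesz (e b x : V) :
    rankTwoForm e b x = riesz 𝕜 V (x + inner 𝕜 e x • b + inner 𝕜 b x • e) := rfl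

theorem rankTwoForm_apply (e b x y : V) :
    rankTwoForm e b x y
      = inner 𝕜 y x + inner 𝕜 e x * inner 𝕜 y b + inner 𝕜 b x * inner 𝕜 y e := by
  rw [rankTwoForm_eq_riesz, riesz_apply, inner_add_right, inner_add_right, inner_smul_right,
    inner_smul_right]

theorem rankTwoForm_symm (e b x y : V) :
    rankTwoForm e b x y = starRingEnd 𝕜 (rankTwoForm e b y x) := by
  simp only [rankTwoForm_apply, map_add, map_mul, inner_conj_symm]
  ring

theorem norm_inner_mul_inner_le (a b x y : V) :
    ‖(inner 𝕜 a x * inner 𝕜 y b : 𝕜)‖ ≤ ‖a‖ * ‖b‖ * ‖x‖ * ‖y‖ := by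
  rw [norm_mul]
  calc _ ≤ (‖a‖ * ‖x‖) * (‖y‖ * ‖b‖) := by
        gcongr <;> exact norm_inner_le_norm _ _
    _ = _ := by ring

theorem norm_rankTwoForm_apply_le (e b x y : V) :
    ‖(rankTwoForm e b x y : 𝕜)‖ ≤ (1 + 2 * (‖e‖ * ‖b‖)) * ‖x‖ * ‖y‖ := by
  rw [rankTwoForm_apply]
  have h1 := norm_inner_le_norm (𝕜 := 𝕜) y x
  have h2 := norm_inner_mul_inner_le (𝕜 := 𝕜) e b x y
  have h3 := norm_inner_mul_inner_le (𝕜 := 𝕜) b e x y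
  refine norm_add₃_le.trans ?_
  linarith

theorem rankTwoForm_coercive (e b x : V) :
    (1 - 2 * (‖e‖ * ‖b‖)) * ‖x‖ ^ 2 ≤ RCLike.re (rankTwoForm e b x x : 𝕜) := by
  rw [rankTwoForm_apply, map_add, map_add, inner_self_eq_norm_sq]
  have h2 := (RCLike.abs_re_le_norm _).trans (norm_inner_mul_inner_le (𝕜 := 𝕜) e b x x)
  have h3 := (RCLike.abs_re_le_norm _).trans (norm_inner_mul_inner_le (𝕜 := 𝕜) b e x x)
  have h2' := (abs_le.1 h2).1
  have h3' := (abs_le.1 h3).1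
  linarith

/-- The inner product cancels and the rest is additive in `b`, so the form inherits the modulus of
continuity of `b`. -/
theorem norm_rankTwoForm_sub_le (e b b' : V) :
    ‖(rankTwoForm e b - rankTwoForm e b' : V →L[𝕜] Antidual 𝕜 V)‖ ≤ 2 * ‖e‖ * ‖b - b'‖ := by
  refine ContinuousLinearMap.opNorm_le_bound _ (by positivity) fun x =>
    ContinuousLinearMap.opNorm_le_bound _ (by positivity) fun y => ?_
  have h : (rankTwoForm e b - rankTwoForm e b' : V →L[𝕜] Antidual 𝕜 V) x y
      = inner 𝕜 e x * inner 𝕜 y (b - b') + inner 𝕜 (b - b') x * inner 𝕜 y e := by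
    change (rankTwoForm e b x y - rankTwoForm e b' x y : 𝕜) = _
    simp only [rankTwoForm_apply, inner_sub_left, inner_sub_right]
    ring
  rw [h]
  have h2 := norm_inner_mul_inner_le (𝕜 := 𝕜) e (b - b') x y
  have h3 := norm_inner_mul_inner_le (𝕜 := 𝕜) (b - b') e x y
  refine (norm_add_le _ _).trans ?_
  linarith

theorem continuous_rankTwoForm (e : V) :
    Continuous (rankTwoForm e : V → V →L[𝕜] Antidual 𝕜 V) := by
  refine (LipschitzWith.of_dist_le_mul (α := V)
    (β := V →L[𝕜] Antidual 𝕜 V) (K := 2 * ‖e‖₊) fun b b' => ?_).continuous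
  have h := norm_rankTwoForm_sub_le (𝕜 := 𝕜) e b b'
  rw [← dist_eq_norm b b'] at h
  exact (dist_eq_norm (rankTwoForm e b : V →L[𝕜] Antidual 𝕜 V) _).trans_le h

/-! ### The counterexample over an abstract Gelfand triple -/

/-- A family `e n` in `V` whose images in `H` are orthogonal to each other and to `h₀`, such that
`j† j` acts on `e n` like multiplication by `1 / (L 4ⁿ)`. -/
structure IsLacunaryFamily (j : V →L[𝕜] H) (L c : ℝ) (h₀ : H) (e : ℕ → V) : Prop where
  one_le_L : 1 ≤ L
  c_pos : 0 < c
  norm_adjoint : ‖ContinuousLinearMap.adjoint j h₀‖ = 1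
  norm_le : ∀ n, ‖e n‖ ≤ 1
  orthogonal : ∀ n m, n ≠ m → inner 𝕜 (j (e n)) (j (e m)) = 0
  orthogonal_zero : ∀ n, inner 𝕜 h₀ (j (e n)) = 0
  -- `lower` forces the derivative to blow up in `H`; `upper` keeps it bounded after applying `j†`.
  lower : ∀ n, c / (L * 4 ^ n) ≤ ‖j (e n)‖ ^ 2
  upper : ∀ n, (L * 4 ^ n) * ‖ContinuousLinearMap.adjoint j (j (e n))‖ ≤ 1

variable [NormedSpace ℝ V] [IsScalarTower ℝ 𝕜 V] [NormedSpace ℝ H] [IsScalarTower ℝ 𝕜 H]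

/-- The oscillating part of the solution. -/
def lacunaryPart (L : ℝ) (e : ℕ → V) : ℝ → V := lacunary L Real.cos e

/-- The time derivative of `j† j` applied to the lacunaryPart. -/
def lacunaryPartDeriv (j : V →L[𝕜] H) (L : ℝ) (e : ℕ → V) : ℝ → V :=
  lacunary L (fun s => -Real.sin s)
    fun n => (L * 4 ^ n) • ContinuousLinearMap.adjoint j (j (e n))

/-- The perturbation that defines the form. -/
def perturbation (j : V →L[𝕜] H) (L : ℝ) (e : ℕ → V) (t : ℝ) : V :=
  -((1 / 16 : ℝ) • (lacunaryPart L e t + lacunaryPartDeriv j L e t))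

/-- The non-autonomous form of the counterexample. -/
def lacunaryForm (j : V →L[𝕜] H) (L : ℝ) (h₀ : H) (e : ℕ → V) (t : ℝ) :
    V →L[𝕜] Antidual 𝕜 V :=
  rankTwoForm (ContinuousLinearMap.adjoint j h₀) (perturbation j L e t)

/-- The profile `v` such that `t v(t)` is a solution that is not in `H¹(0, T; H)`. -/
def profile (j : V →L[𝕜] H) (L : ℝ) (h₀ : H) (e : ℕ → V) (t : ℝ) : V :=
  ContinuousLinearMap.adjoint j h₀ + (1 / 16 : ℝ) • lacunaryPart L e t

theorem abs_neg_sin_le_one (s : ℝ) : |(-Real.sin s)| ≤ 1 := by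
  rw [abs_neg]; exact Real.abs_sin_le_one s

theorem abs_cos_sub_cos_le (s t : ℝ) : |Real.cos s - Real.cos t| ≤ |s - t| := by
  have := (Real.lipschitzWith_cos).dist_le_mul s t
  simpa [Real.dist_eq] using this

theorem abs_neg_sin_sub_le (s t : ℝ) : |(-Real.sin s) - (-Real.sin t)| ≤ |s - t| := by
  have := (Real.lipschitzWith_sin).dist_le_mul t s
  rw [neg_sub_neg, abs_sub_comm s t]
  simpa [Real.dist_eq] using this

namespace IsLacunaryFamily

variable {j : V →L[𝕜] H} {L c : ℝ} {h₀ : H} {e : ℕ → V} (hE : IsLacunaryFamily j L c h₀ e)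
include hE

theorem L_pos : 0 < L := zero_lt_one.trans_le hE.one_le_L

theorem norm_upper (n : ℕ) :
    ‖(L * 4 ^ n) • ContinuousLinearMap.adjoint j (j (e n))‖ ≤ 1 := by
  have := hE.L_pos
  rw [norm_smul, Real.norm_of_nonneg (by positivity)]
  exact hE.upper n

theorem continuous_lacunaryPart : Continuous (lacunaryPart L e) :=
  continuous_lacunary Real.abs_cos_le_one Real.continuous_cos hE.norm_le

theorem continuous_lacunaryPartDeriv : Continuous (lacunaryPartDeriv j L e) :=
  continuous_lacunary abs_neg_sin_le_one (by fun_prop) hE.norm_upper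

theorem continuous_perturbation : Continuous (perturbation j L e) :=
  ((hE.continuous_lacunaryPart.add hE.continuous_lacunaryPartDeriv).const_smul (1 / 16 : ℝ)).neg

theorem continuous_profile : Continuous (profile j L h₀ e) :=
  continuous_const.add (hE.continuous_lacunaryPart.const_smul (1 / 16 : ℝ))

/-- Each series has norm at most 2, so the factor `1/16` gives `1/4`, which leaves the coercivity
constant `1 - 2 · 1/4 = 1/2`. -/
theorem norm_perturbation_le (t : ℝ) : ‖perturbation j L e t‖ ≤ 1 / 4 := by
  have h1 : ‖lacunaryPart L e t‖ ≤ 2 := norm_lacunary_le Real.abs_cos_le_one hE.norm_le t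
  have h2 : ‖lacunaryPartDeriv j L e t‖ ≤ 2 :=
    norm_lacunary_le abs_neg_sin_le_one hE.norm_upper t
  have h3 := norm_add_le (lacunaryPart L e t) (lacunaryPartDeriv j L e t)
  rw [perturbation, norm_neg, norm_smul, Real.norm_of_nonneg (by norm_num)]
  linarith

theorem continuous_lacunaryForm : Continuous (lacunaryForm j L h₀ e) :=
  (continuous_rankTwoForm _).comp hE.continuous_perturbation

theorem isNonautonomousForm (T : ℝ) : IsNonautonomousForm T (lacunaryForm j L h₀ e) where
  measurable v w := by
    have h := hE.continuous_lacunaryForm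
    have : Continuous fun t : ℝ => lacunaryForm j L h₀ e t v w := by fun_prop
    exact this.measurable.comp measurable_subtype_coe
  bounded := by
    refine ⟨2, by norm_num, fun t _ v w => (norm_rankTwoForm_apply_le _ _ v w).trans ?_⟩
    have := hE.norm_perturbation_le t
    rw [hE.norm_adjoint]
    gcongr
    linarith

theorem isCoerciveForm (T : ℝ) : IsCoerciveForm T (lacunaryForm j L h₀ e) := by
  refine ⟨1 / 2, by norm_num, fun t _ v => le_trans ?_ (rankTwoForm_coercive _ _ v)⟩
  have := hE.norm_perturbation_le t
  rw [hE.norm_adjoint]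
  gcongr
  linarith

omit hE in
theorem isSymmetricForm (T : ℝ) : IsSymmetricForm T (lacunaryForm j L h₀ e) :=
  fun _ _ v w => rankTwoForm_symm _ _ v w

theorem memBesov {T : ℝ} (hT : 0 < T) (p : ℝ≥0∞) {q : ℝ≥0∞} (hq : 2 < q) :
    MemBesov T (1 / 2) p q (lacunaryForm j L h₀ e) := by
  have hC : 0 ≤ max 2 (L * T) := le_max_of_le_left (by norm_num)
  refine memBesov_of_modulus hT hq hE.continuous_lacunaryForm (C := 2 * (5 * max 2 (L * T))) (by positivity)
    fun m h h0 hm t => ?_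
  refine (norm_rankTwoForm_sub_le _ _ _).trans ?_
  rw [hE.norm_adjoint]
  have h1 : ‖lacunaryPart L e (t + h) - lacunaryPart L e t‖ ≤ 5 * max 2 (L * T) * amp m :=
    norm_lacunary_sub_le hE.L_pos.le Real.abs_cos_le_one abs_cos_sub_cos_le hE.norm_le m h0 hm t
  have h2 : ‖lacunaryPartDeriv j L e (t + h) - lacunaryPartDeriv j L e t‖
      ≤ 5 * max 2 (L * T) * amp m :=
    norm_lacunary_sub_le hE.L_pos.le abs_neg_sin_le_one abs_neg_sin_sub_le hE.norm_upper m h0 hm t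
  have h3 : perturbation j L e (t + h) - perturbation j L e t
      = -((1 / 16 : ℝ) • ((lacunaryPart L e (t + h) - lacunaryPart L e t) +
        (lacunaryPartDeriv j L e (t + h) - lacunaryPartDeriv j L e t))) := by
    unfold perturbation
    module
  have h4 := norm_add_le (lacunaryPart L e (t + h) - lacunaryPart L e t)
    (lacunaryPartDeriv j L e (t + h) - lacunaryPartDeriv j L e t)
  rw [h3, norm_neg, norm_smul, Real.norm_of_nonneg (by norm_num)]
  have := amp_pos m
  have : 0 ≤ 5 * max 2 (L * T) * amp m := by positivity
  linarith

/-! ### The explicit solution -/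

theorem inner_adjoint_profile (t : ℝ) :
    inner 𝕜 (ContinuousLinearMap.adjoint j h₀) (profile j L h₀ e t) = 1 := by
  -- Moving `j†` across turns this into the orthogonality of `h₀` and all `j (e n)`.
  have h : inner 𝕜 (ContinuousLinearMap.adjoint j h₀) (lacunaryPart L e t) = 0 := by
    rw [ContinuousLinearMap.adjoint_inner_left]
    have hs := summable_lacunary (L := L) Real.abs_cos_le_one hE.norm_le t
    change innerSL 𝕜 h₀ (j (∑' n, _)) = 0
    rw [j.map_tsum hs, (innerSL 𝕜 h₀).map_tsum (j.summable hs), ← tsum_zero]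
    congr 1
    ext n
    rw [RCLike.real_smul_eq_coe_smul (K := 𝕜), map_smul, map_smul, innerSL_apply_apply,
      hE.orthogonal_zero, smul_zero]
  rw [profile, inner_add_right, RCLike.real_smul_eq_coe_smul (K := 𝕜), inner_smul_right, h,
    inner_self_eq_norm_sq_to_K, hE.norm_adjoint]
  simp

/-- Without `j†j` the differentiated coefficients would grow like `2ⁿ/√(n+1)`; `j†j` supplies the
missing factor `4⁻ⁿ`. -/
theorem hasDerivAt_adjoint_lacunaryPart (t : ℝ) :
    HasDerivAt (fun s => ContinuousLinearMap.adjoint j (j (lacunaryPart L e s)))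
      (lacunaryPartDeriv j L e t) t := by
  have hk : ∀ n, ‖ContinuousLinearMap.adjoint j (j (e n))‖ ≤ 1 := by
    intro n
    refine le_trans (le_mul_of_one_le_left (norm_nonneg _) ?_) (hE.upper n)
    exact one_le_mul_of_one_le_of_one_le hE.one_le_L (one_le_pow₀ (by norm_num))
  have h := hasDerivAt_lacunary_cos hk hE.norm_upper t
  refine h.congr_of_eventuallyEq (Filter.Eventually.of_forall fun s => ?_)
  have hs := summable_lacunary (L := L) Real.abs_cos_le_one hE.norm_le s
  change ContinuousLinearMap.adjoint j (j (∑' n, _)) = ∑' n, _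
  rw [j.map_tsum hs, (ContinuousLinearMap.adjoint j).map_tsum (j.summable hs)]
  congr 1
  ext n
  simp only [RCLike.real_smul_eq_coe_smul (K := 𝕜), map_smul]

theorem hasDerivAt_pivot (t : ℝ) :
    HasDerivAt (fun s => pivot j (j (profile j L h₀ e s)))
      (riesz 𝕜 V ((1 / 16 : ℝ) • lacunaryPartDeriv j L e t)) t := by
  have h1 : HasDerivAt (fun s => ContinuousLinearMap.adjoint j (j (profile j L h₀ e s)))
      ((1 / 16 : ℝ) • lacunaryPartDeriv j L e t) t := by
    have := ((hE.hasDerivAt_adjoint_lacunaryPart t).const_smul (1 / 16 : ℝ)).const_add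
      (ContinuousLinearMap.adjoint j (j (ContinuousLinearMap.adjoint j h₀)))
    refine this.congr_of_eventuallyEq (Filter.Eventually.of_forall fun s => ?_)
    simp only [profile, map_add, RCLike.real_smul_eq_coe_smul (K := 𝕜), map_smul, Pi.smul_apply]
  have h2 := ((riesz 𝕜 V).restrictScalars ℝ).hasFDerivAt.comp_hasDerivAt t h1
  refine h2.congr_of_eventuallyEq (Filter.Eventually.of_forall fun s => ?_)
  exact pivot_eq_riesz j _

/-- The factor `s` makes the initial value zero, at the price of one extra term that lies in `H`. -/
theorem hasDerivAt_pivot_smul (t : ℝ) :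
    HasDerivAt (fun s : ℝ => pivot j (j (s • profile j L h₀ e s)))
      (pivot j (j (profile j L h₀ e t)) +
        t • riesz 𝕜 V ((1 / 16 : ℝ) • lacunaryPartDeriv j L e t)) t := by
  have h := (hasDerivAt_id t).smul (hE.hasDerivAt_pivot t)
  rw [one_smul, add_comm] at h
  refine h.congr_of_eventuallyEq (Filter.Eventually.of_forall fun s => ?_)
  ext y
  simp only [pivot_apply, RCLike.real_smul_eq_coe_smul (K := 𝕜), map_smul, inner_smul_right,
    Pi.smul_apply', id_eq, smul_apply, smul_eq_mul]

/-- The right-hand side for which `t v(t)` is the solution. -/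
theorem residual_eq (t : ℝ) :
    pivot j (j (profile j L h₀ e t)) +
        t • riesz 𝕜 V ((1 / 16 : ℝ) • lacunaryPartDeriv j L e t) +
      lacunaryForm j L h₀ e t (t • profile j L h₀ e t) =
    pivot j (j (profile j L h₀ e t) +
      ((t : 𝕜) * (1 + inner 𝕜 (perturbation j L e t) (profile j L h₀ e t))) • h₀) := by
  -- Because this pairing is 1, the form adds exactly `b` and a multiple of `j†h₀` to the profile;
  -- the definition of `b` then removes the lacunary part and its derivative.
  have h := hE.inner_adjoint_profile t
  have hr : ∀ (r : ℝ) (x : V), r • riesz 𝕜 V x = riesz 𝕜 V (r • x) := fun r x =>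
    (((riesz 𝕜 V).restrictScalars ℝ).map_smul r x).symm
  rw [lacunaryForm, rankTwoForm_eq_riesz, pivot_eq_riesz, pivot_eq_riesz, hr, ← map_add,
    ← map_add]
  congr 1
  rw [map_add (ContinuousLinearMap.adjoint j), map_smul]
  rw [RCLike.real_smul_eq_coe_smul (K := 𝕜) t (profile j L h₀ e t), inner_smul_right,
    inner_smul_right, h]
  generalize inner 𝕜 (perturbation j L e t) (profile j L h₀ e t) = a
  generalize ContinuousLinearMap.adjoint j (j (profile j L h₀ e t)) = k
  unfold profile perturbation
  simp only [RCLike.real_smul_eq_coe_smul (K := 𝕜)]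
  module

theorem isSolution {T : ℝ} (hT : 0 ≤ T) :
    IsSolution j T (lacunaryForm j L h₀ e) 0
      (fun t => pivot j (j (profile j L h₀ e t) +
        ((t : 𝕜) * (1 + inner 𝕜 (perturbation j L e t) (profile j L h₀ e t))) • h₀))
      (fun t => t • profile j L h₀ e t) := by
  have hv := hE.continuous_profile
  have hu : Continuous fun t : ℝ => t • profile j L h₀ e t := continuous_id.smul hv
  have hc : Continuous fun t : ℝ => pivot j (j (profile j L h₀ e t)) +
        t • riesz 𝕜 V ((1 / 16 : ℝ) • lacunaryPartDeriv j L e t) :=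
    (continuous_iff_continuousAt.2 fun t => (hE.hasDerivAt_pivot t).continuousAt).add
      (continuous_id.smul ((riesz 𝕜 V).continuous.comp
        (hE.continuous_lacunaryPartDeriv.const_smul (1 / 16 : ℝ))))
  refine ⟨memL2_of_continuous hu, ⟨_, memL2_of_continuous hc,
    hasWeakDeriv_of_hasDerivAt hT hE.hasDerivAt_pivot_smul hc,
    ae_of_all _ fun t => hE.residual_eq t⟩,
    fun t => pivot j (j (t • profile j L h₀ e t)), ?_, ae_of_all _ fun t => rfl, ?_⟩
  · exact (continuous_iff_continuousAt.2
      fun t => (hE.hasDerivAt_pivot_smul t).continuousAt).continuousOn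
  · simp only [zero_smul, map_zero]

theorem memL2_residual (T : ℝ) :
    MemL2 T fun t : ℝ => j (profile j L h₀ e t) +
      ((t : 𝕜) * (1 + inner 𝕜 (perturbation j L e t) (profile j L h₀ e t))) • h₀ := by
  have h1 := hE.continuous_profile
  have h2 := hE.continuous_perturbation
  have h3 : Continuous fun t : ℝ =>
      (inner 𝕜 (perturbation j L e t) (profile j L h₀ e t) : 𝕜) := h2.inner h1
  have h4 : Continuous fun t : ℝ => (t : 𝕜) := RCLike.continuous_ofReal
  exact memL2_of_continuous ((j.continuous.comp h1).add
    ((h4.mul (continuous_const.add h3)).smul continuous_const))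

/-! ### The solution is not in `H¹(0, T; H)` -/

theorem inner_profile (n : ℕ) (t : ℝ) :
    inner 𝕜 (j (e n)) (j (profile j L h₀ e t)) =
      inner 𝕜 (j (e n)) (j (ContinuousLinearMap.adjoint j h₀)) +
        ((1 / 16 * (amp n * ‖j (e n)‖ ^ 2) * Real.cos (L * 4 ^ n * t) : ℝ) : 𝕜) := by
  have hs := summable_lacunary (L := L) Real.abs_cos_le_one hE.norm_le t
  have h : inner 𝕜 (j (e n)) (j (lacunaryPart L e t)) =
      ((amp n * Real.cos (L * 4 ^ n * t) * ‖j (e n)‖ ^ 2 : ℝ) : 𝕜) := by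
    change innerSL 𝕜 (j (e n)) (j (∑' m, _)) = _
    rw [j.map_tsum hs, (innerSL 𝕜 (j (e n))).map_tsum (j.summable hs), tsum_eq_single n]
    · rw [RCLike.real_smul_eq_coe_smul (K := 𝕜), map_smul, map_smul, innerSL_apply_apply,
        inner_self_eq_norm_sq_to_K, smul_eq_mul]
      push_cast
      rfl
    · intro m hm
      rw [RCLike.real_smul_eq_coe_smul (K := 𝕜), map_smul, map_smul, innerSL_apply_apply,
        hE.orthogonal n m hm.symm, smul_zero]
  rw [profile, map_add, inner_add_right, RCLike.real_smul_eq_coe_smul (K := 𝕜), map_smul,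
    inner_smul_right, h]
  push_cast
  ring

theorem hasDerivAt_coeff (n : ℕ) (t : ℝ) :
    HasDerivAt (fun s : ℝ => (inner 𝕜 (j (e n)) (j (s • profile j L h₀ e s)) : 𝕜))
      (inner 𝕜 (j (e n)) (j (ContinuousLinearMap.adjoint j h₀)) +
        ((1 / 16 * (amp n * ‖j (e n)‖ ^ 2) * (Real.cos (L * 4 ^ n * t) -
          t * (L * 4 ^ n * Real.sin (L * 4 ^ n * t))) : ℝ) : 𝕜)) t := by
  set A := 1 / 16 * (amp n * ‖j (e n)‖ ^ 2) with hA
  set D : 𝕜 := inner 𝕜 (j (e n)) (j (ContinuousLinearMap.adjoint j h₀)) with hD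
  have h1 : HasDerivAt (fun y : ℝ => L * 4 ^ n * y) (L * 4 ^ n) t := by
    simpa using (hasDerivAt_id t).const_mul (L * 4 ^ n)
  have h2 : HasDerivAt (fun s : ℝ => s * (A * Real.cos (L * 4 ^ n * s)))
      (A * (Real.cos (L * 4 ^ n * t) - t * (L * 4 ^ n * Real.sin (L * 4 ^ n * t)))) t := by
    refine ((hasDerivAt_id t).mul (h1.cos.const_mul A)).congr_deriv ?_
    simp only [id_eq]
    ring
  have h3 := ((hasDerivAt_id t).smul_const D).add
    ((RCLike.ofRealCLM (K := 𝕜)).hasFDerivAt.comp_hasDerivAt t h2)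
  rw [one_smul] at h3
  refine h3.congr_of_eventuallyEq (Filter.Eventually.of_forall fun s => ?_)
  simp only [RCLike.real_smul_eq_coe_smul (K := 𝕜), map_smul, inner_smul_right,
    hE.inner_profile, Pi.add_apply, Function.comp_apply, RCLike.ofRealCLM_apply, id_eq,
    smul_eq_mul, ← hA, ← hD]
  push_cast
  ring

theorem norm_j_pos (n : ℕ) : 0 < ‖j (e n)‖ := by
  have h1 := hE.L_pos
  have h2 := hE.c_pos
  have h3 : 0 < ‖j (e n)‖ ^ 2 := lt_of_lt_of_le (by positivity) (hE.lower n)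
  exact lt_of_pow_lt_pow_left₀ 2 (norm_nonneg _) (by simpa using h3)

/-- Bessel's inequality for the normalized vectors `j (e n)`. -/
theorem sum_inner_sq_le (N : ℕ) (x : H) :
    ∑ n ∈ Finset.range N, ‖(inner 𝕜 (j (e n)) x : 𝕜)‖ ^ 2 / ‖j (e n)‖ ^ 2 ≤ ‖x‖ ^ 2 := by
  have hon : Orthonormal 𝕜 fun n => ((‖j (e n)‖⁻¹ : ℝ) : 𝕜) • j (e n) := by
    refine ⟨fun n => ?_, fun n m hnm => ?_⟩
    · have := hE.norm_j_pos n
      rw [norm_smul, RCLike.norm_ofReal, abs_of_pos (by positivity)]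
      field_simp
    · simp only [inner_smul_left, inner_smul_right, hE.orthogonal n m hnm, mul_zero]
  refine le_trans (le_of_eq (Finset.sum_congr rfl fun n _ => ?_))
    (hon.sum_inner_products_le (x := x) (s := Finset.range N))
  rw [inner_smul_left, norm_mul, RCLike.norm_conj, RCLike.norm_ofReal, mul_pow, sq_abs, inv_pow]
  ring

/-- A weak derivative `g` in `L²(0, T; H)` would have the computed coefficients along every `j (e
n)`; Bessel's inequality integrated in time then bounds a multiple of the harmonic series. -/
theorem not_memH1 {T : ℝ} (hT : 0 < T) :
    ¬ MemH1 T fun t : ℝ => j (t • profile j L h₀ e t) := by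
  rintro ⟨hu, g, hg, hgu⟩
  have hL := hE.L_pos
  have hc := hE.c_pos
  -- Subtracting `b` from `g` removes the constant part of the derivative, so that only the
  -- oscillating modes remain.
  set b : H := j (ContinuousLinearMap.adjoint j h₀)
  set ψ : ℕ → ℝ → ℝ := fun n t => (Real.cos (L * 4 ^ n * t) -
          t * (L * 4 ^ n * Real.sin (L * 4 ^ n * t))) ^ 2 with hψ
  have hψc : ∀ n, Continuous (ψ n) := fun n => by simp only [hψ]; fun_prop
  have hψi : ∀ n, Integrable (ψ n) (volume.restrict (Ioo 0 T)) :=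
    fun n => (memL2_of_continuous (hψc n)).integrable
  have hcoef : ∀ n, ∀ᵐ t ∂(volume.restrict (Ioo 0 T)),
      ‖(inner 𝕜 (j (e n)) (g t - b) : 𝕜)‖ ^ 2 / ‖j (e n)‖ ^ 2
        = 1 / 256 * (amp n ^ 2 * ‖j (e n)‖ ^ 2) * ψ n t := by
    intro n
    set l : H →L[ℝ] 𝕜 := (innerSL 𝕜 (j (e n))).restrictScalars ℝ
    have h1 := hgu.clm_comp hu hg l
    have hcont : Continuous fun t : ℝ => (inner 𝕜 (j (e n)) b +
        ((1 / 16 * (amp n * ‖j (e n)‖ ^ 2) * (Real.cos (L * 4 ^ n * t) -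
          t * (L * 4 ^ n * Real.sin (L * 4 ^ n * t))) : ℝ) : 𝕜)) :=
      continuous_const.add (RCLike.continuous_ofReal.comp (by fun_prop))
    have h2 := hasWeakDeriv_of_hasDerivAt hT.le (hE.hasDerivAt_coeff n) hcont
    have hlg : MemL2 T fun t => l (g t) := l.comp_memLp' hg
    filter_upwards [h1.ae_eq h2 hlg (memL2_of_continuous hcont)] with t ht
    have hpos := hE.norm_j_pos n
    have ht' : (inner 𝕜 (j (e n)) (g t) : 𝕜) = inner 𝕜 (j (e n)) b +
        ((1 / 16 * (amp n * ‖j (e n)‖ ^ 2) * (Real.cos (L * 4 ^ n * t) -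
          t * (L * 4 ^ n * Real.sin (L * 4 ^ n * t))) : ℝ) : 𝕜) := ht
    rw [inner_sub_right, ht', add_sub_cancel_left, RCLike.norm_ofReal, sq_abs, hψ]
    field_simp
    ring
  have hG : Integrable (fun t => ‖g t - b‖ ^ 2) (volume.restrict (Ioo 0 T)) :=
    (MemLp.sub hg (memLp_const b)).norm.integrable_sq
  set β : ℕ → ℝ := fun n => 1 / 256 * (amp n ^ 2 * ‖j (e n)‖ ^ 2) * ∫ t in Ioo 0 T, ψ n t with hβ
  have hβ0 : ∀ n, 0 ≤ β n := fun n =>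
    mul_nonneg (by positivity) (integral_nonneg fun t => sq_nonneg _)
  have hsum : Summable β := by
    refine summable_of_sum_range_le hβ0 (c := ∫ t in Ioo 0 T, ‖g t - b‖ ^ 2) fun N => ?_
    have : ∑ n ∈ Finset.range N, β n = ∫ t in Ioo 0 T, ∑ n ∈ Finset.range N,
        1 / 256 * (amp n ^ 2 * ‖j (e n)‖ ^ 2) * ψ n t := by
      rw [integral_finsetSum _ fun n _ => (hψi n).const_mul _]
      exact Finset.sum_congr rfl fun n _ => (integral_const_mul _ _).symm
    rw [this]
    refine integral_mono_ae (integrable_finsetSum _ fun n _ => (hψi n).const_mul _) hG ?_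
    filter_upwards [ae_all_iff.2 hcoef] with t ht
    simp only [← ht]
    exact hE.sum_inner_sq_le N _
  -- Here `16384 = 256 · 64`; all powers of 4 cancel. Only large `n` satisfy `T L 4ⁿ ≥ 8`.
  have hlow : ∀ᶠ n : ℕ in Filter.atTop, c * L * T ^ 3 / 16384 * (1 / ((n : ℝ) + 1)) ≤ β n := by
    have htend : Filter.Tendsto (fun n : ℕ => T * (L * 4 ^ n)) Filter.atTop Filter.atTop :=
      ((tendsto_pow_atTop_atTop_of_one_lt (by norm_num)).const_mul_atTop hL).const_mul_atTop hT
    filter_upwards [htend.eventually_ge_atTop 8] with n hn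
    have h1 := integral_sq_cos_sub_ge hT hn
    have h2 := hE.lower n
    calc _ = 1 / 256 * (1 / (4 ^ n * ((n : ℝ) + 1)) * (c / (L * 4 ^ n))) *
          (T ^ 3 / 64 * (L * 4 ^ n) ^ 2) := by
          field_simp
          norm_num
      _ ≤ β n := by
          simp only [hβ, amp_sq]
          gcongr
  have hs2 : Summable fun n : ℕ => c * L * T ^ 3 / 16384 * (1 / ((n : ℝ) + 1)) := by
    refine Summable.of_norm_bounded_eventually_nat hsum ?_
    filter_upwards [hlow] with n hn
    rwa [Real.norm_of_nonneg (by positivity)]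
  have hs3 : Summable fun n : ℕ => 1 / ((n : ℝ) + 1) :=
    (summable_mul_left_iff (by positivity)).1 hs2
  refine Real.not_summable_one_div_natCast ((summable_nat_add_iff 1).1 ?_)
  simpa using hs3

theorem not_hasMaximalRegularity {T : ℝ} (hT : 0 < T) :
    ¬ HasMaximalRegularity j T (lacunaryForm j L h₀ e) := fun h =>
  hE.not_memH1 hT (h _ (hE.memL2_residual T) _ (hE.isSolution hT.le))

end IsLacunaryFamily

end Abstract

/-! ### The weight and its level bands -/

section Weight

theorem measurable_weight : Measurable weight := by
  unfold weight
  exact (measurable_id.mul (Real.measurable_log.comp measurable_id).abs).pow_const _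

theorem mul_abs_log_mem {x : ℝ} (hx : x ∈ Ioo (0 : ℝ) (1 / 2)) :
    0 < x * |Real.log x| ∧ x * |Real.log x| ≤ 1 := by
  have h1 : Real.log x < 0 := Real.log_neg hx.1 (by linarith [hx.2])
  refine ⟨mul_pos hx.1 (abs_pos.2 h1.ne), ?_⟩
  have := (Real.abs_log_mul_self_lt x hx.1 (by linarith [hx.2])).le
  rwa [abs_mul, abs_of_pos hx.1, mul_comm] at this

theorem one_le_weight {x : ℝ} (hx : x ∈ Ioo (0 : ℝ) (1 / 2)) : 1 ≤ weight x :=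
  Real.one_le_rpow_of_pos_of_le_one_of_nonpos (mul_abs_log_mem hx).1 (mul_abs_log_mem hx).2
    (by norm_num)

theorem ae_one_le_weight : ∀ᵐ x ∂baseMeasure, 1 ≤ weight x := by
  filter_upwards [ae_restrict_mem measurableSet_Ioo] with x hx using one_le_weight hx

theorem baseMeasure_le_weightedMeasure : baseMeasure ≤ weightedMeasure := by
  conv_lhs => rw [← withDensity_one (μ := baseMeasure)]
  refine withDensity_mono ?_
  filter_upwards [ae_one_le_weight] with x hx
  simpa using hx

theorem weightedMeasure_absolutelyContinuous : weightedMeasure ≪ baseMeasure :=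
  withDensity_absolutelyContinuous _ _

theorem baseMeasure_absolutelyContinuous : baseMeasure ≪ weightedMeasure :=
  Measure.absolutelyContinuous_of_le baseMeasure_le_weightedMeasure

/-- Intermediate value theorem for `-x log x` on `[0, 1/4]` at height `y^(-2/3)`. The bound 8
suffices since `8^(-2/3) = 1/4 ≤ (log 4)/4`. -/
theorem exists_weight_eq {y : ℝ} (hy : 8 ≤ y) : ∃ x ∈ Ioo (0 : ℝ) (1 / 2),
    weight x = y ∧ ContinuousAt weight x := by
  have hy0 : 0 < y := by linarith
  set z := y ^ (-(2 / 3) : ℝ) with hz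
  have hz0 : 0 < z := Real.rpow_pos_of_pos hy0 _
  have hz1 : z ≤ 1 / 4 := by
    calc z ≤ 8 ^ (-(2 / 3) : ℝ) :=
          Real.rpow_le_rpow_of_nonpos (by norm_num) hy (by norm_num)
      _ = 1 / 4 := by
          rw [show (8 : ℝ) = 2 ^ (3 : ℝ) by norm_num, ← Real.rpow_mul (by norm_num)]
          norm_num
  have hlog4 : 1 ≤ Real.log 4 := by
    rw [Real.le_log_iff_exp_le (by norm_num)]
    linarith [Real.exp_one_lt_d9]
  have hmem : z ∈ Icc (Real.negMulLog 0) (Real.negMulLog (1 / 4)) := by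
    refine ⟨by simpa using hz0.le, hz1.trans ?_⟩
    rw [Real.negMulLog, one_div, Real.log_inv]
    linarith
  obtain ⟨x, ⟨hx0, hx1⟩, hx⟩ := intermediate_value_Icc (by norm_num : (0 : ℝ) ≤ 1 / 4)
    Real.continuous_negMulLog.continuousOn hmem
  have hx0' : 0 < x := by
    rcases hx0.eq_or_lt with rfl | h
    · simp at hx; linarith
    · exact h
  have hl : Real.log x < 0 := Real.log_neg hx0' (by linarith)
  have hval : x * |Real.log x| = z := by
    rw [abs_of_neg hl, ← hx, Real.negMulLog]; ring
  refine ⟨x, ⟨hx0', by linarith⟩, ?_, ?_⟩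
  · rw [weight, hval, hz, ← Real.rpow_mul hy0.le]
    norm_num
  · unfold weight
    refine ContinuousAt.rpow_const ?_ (Or.inl (by rw [hval]; exact hz0.ne'))
    exact continuousAt_id.mul (Real.continuousAt_log hx0'.ne').abs

/-- The set on which the weight lies between `4ⁿ⁺¹` and `4ⁿ⁺²`. -/
def band (n : ℕ) : Set ℝ := Ioo 0 (1 / 2) ∩ weight ⁻¹' Ico (4 ^ (n + 1)) (4 ^ (n + 2))

theorem measurableSet_band (n : ℕ) : MeasurableSet (band n) :=
  measurableSet_Ioo.inter (measurable_weight measurableSet_Ico)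

/-- The weight attains the interior value `2 · 4ⁿ⁺¹ ≥ 8` at a continuity point, so the band contains
a neighbourhood of it. -/
theorem baseMeasure_band_pos (n : ℕ) : 0 < baseMeasure (band n) := by
  have h8 : (8 : ℝ) ≤ 2 * 4 ^ (n + 1) := by
    have : (1 : ℝ) ≤ 4 ^ n := one_le_pow₀ (by norm_num)
    rw [pow_succ]; linarith
  obtain ⟨x, hx, hw, hc⟩ := exists_weight_eq h8
  have hmem : band n ∈ nhds x := by
    refine Filter.inter_mem (Ioo_mem_nhds hx.1 hx.2) (hc.preimage_mem_nhds ?_)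
    have : (0 : ℝ) < 4 ^ (n + 1) := by positivity
    rw [hw]
    exact Ico_mem_nhds (by linarith) (by rw [pow_succ _ (n + 1)]; linarith)
  rw [baseMeasure, Measure.restrict_apply (measurableSet_band n),
    inter_eq_left.2 (show band n ⊆ _ from inter_subset_left)]
  exact Measure.measure_pos_of_mem_nhds volume hmem

theorem disjoint_band {n m : ℕ} (h : n ≠ m) : Disjoint (band n) (band m) := by
  wlog hlt : n < m generalizing n m
  · exact (this h.symm (lt_of_le_of_ne (not_lt.1 hlt) h.symm)).symm
  refine disjoint_left.2 fun x hx hx' => ?_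
  have h1 : (4 : ℝ) ^ (n + 2) ≤ 4 ^ (m + 1) := pow_le_pow_right₀ (by norm_num) (by omega)
  exact absurd (hx.2.2.trans_le (h1.trans hx'.2.1)) (lt_irrefl _)

theorem lintegral_band_weightedMeasure (n : ℕ) (f : ℝ → ℝ≥0∞) :
    ∫⁻ x in band n, f x ∂weightedMeasure
      = ∫⁻ x in band n, ENNReal.ofReal (weight x) * f x ∂baseMeasure := by
  rw [weightedMeasure, restrict_withDensity (measurableSet_band n),
    lintegral_withDensity_eq_lintegral_mul_non_measurable _ measurable_weight.ennreal_ofReal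
      (ae_of_all _ fun _ => ENNReal.ofReal_lt_top)]
  rfl

theorem lintegral_band_le (n : ℕ) (f : ℝ → ℝ≥0∞) :
    ENNReal.ofReal (4 ^ (n + 1)) * ∫⁻ x in band n, f x ∂baseMeasure
      ≤ ∫⁻ x in band n, f x ∂weightedMeasure := by
  rw [lintegral_band_weightedMeasure, ← lintegral_const_mul' _ _ ENNReal.ofReal_ne_top]
  refine setLIntegral_mono' (measurableSet_band n) fun x hx => ?_
  gcongr
  exact hx.2.1

theorem weightedMeasure_band_le (n : ℕ) :
    weightedMeasure (band n) ≤ ENNReal.ofReal (4 ^ (n + 2)) * baseMeasure (band n) := by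
  rw [← setLIntegral_one, ← setLIntegral_one, lintegral_band_weightedMeasure,
    ← lintegral_const_mul' _ _ ENNReal.ofReal_ne_top]
  refine setLIntegral_mono' (measurableSet_band n) fun x hx => ?_
  gcongr
  exact hx.2.2.le

theorem baseMeasure_band_ne_top (n : ℕ) : baseMeasure (band n) ≠ ⊤ := by
  have : IsFiniteMeasure baseMeasure := by unfold baseMeasure; infer_instance
  exact measure_ne_top _ _

theorem weightedMeasure_band_ne_top (n : ℕ) : weightedMeasure (band n) ≠ ⊤ :=
  ((weightedMeasure_band_le n).trans_lt (ENNReal.mul_lt_top ENNReal.ofReal_lt_top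
    (baseMeasure_band_ne_top n).lt_top)).ne

theorem weightedMeasure_real_band_le (n : ℕ) :
    weightedMeasure.real (band n) ≤ 4 ^ (n + 2) * baseMeasure.real (band n) := by
  have := ENNReal.toReal_mono (ENNReal.mul_ne_top ENNReal.ofReal_ne_top
    (baseMeasure_band_ne_top n)) (weightedMeasure_band_le n)
  rwa [ENNReal.toReal_mul, ENNReal.toReal_ofReal (by positivity)] at this

theorem baseMeasure_real_band_pos (n : ℕ) : 0 < baseMeasure.real (band n) :=
  ENNReal.toReal_pos (baseMeasure_band_pos n).ne' (baseMeasure_band_ne_top n)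

theorem weightedMeasure_real_band_pos (n : ℕ) : 0 < weightedMeasure.real (band n) :=
  ENNReal.toReal_pos
    ((baseMeasure_band_pos n).trans_le (baseMeasure_le_weightedMeasure _)).ne'
    (weightedMeasure_band_ne_top n)

end Weight

/-! ### The concrete Gelfand triple and its lacunary family -/

section Embedding

variable (𝕜 : Type) [RCLike 𝕜]

/-- The inclusion `V → H`. -/
def spaceInclusion : SpaceV 𝕜 →L[𝕜] SpaceH 𝕜 :=
  LinearMap.mkContinuous
    { toFun := fun v => ((Lp.memLp v).mono_measure baseMeasure_le_weightedMeasure).toLp v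
      map_add' := fun v w => by
        rw [← MemLp.toLp_add]
        exact MemLp.toLp_congr _ _
          (baseMeasure_absolutelyContinuous.ae_le (Lp.coeFn_add v w))
      map_smul' := fun r v => by
        rw [RingHom.id_apply, ← MemLp.toLp_const_smul]
        exact MemLp.toLp_congr _ _
          (baseMeasure_absolutelyContinuous.ae_le (Lp.coeFn_smul r v)) } 1 fun v => by
    rw [one_mul]
    change ‖((Lp.memLp v).mono_measure baseMeasure_le_weightedMeasure).toLp v‖ ≤ _
    rw [Lp.norm_toLp, Lp.norm_def]
    exact ENNReal.toReal_mono (Lp.eLpNorm_ne_top v)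
      (eLpNorm_mono_measure _ baseMeasure_le_weightedMeasure)

variable {𝕜}

theorem inclusion_ae_eq (v : SpaceV 𝕜) :
    ∀ᵐ x ∂baseMeasure, (spaceInclusion 𝕜 v : ℝ → 𝕜) x = (v : ℝ → 𝕜) x :=
  MemLp.coeFn_toLp ((Lp.memLp v).mono_measure baseMeasure_le_weightedMeasure)

theorem inclusion_injective : Function.Injective (spaceInclusion 𝕜) := by
  intro v w h
  refine Lp.ext (weightedMeasure_absolutelyContinuous.ae_le ?_)
  filter_upwards [inclusion_ae_eq v, inclusion_ae_eq w] with x hv hw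
  rw [← hv, ← hw, h]

/-- Since `w · w⁻² = w⁻¹ ≤ 1`. This function is the test vector for density. -/
theorem memLp_inv_weight_smul (h : SpaceH 𝕜) :
    MemLp (fun x => (weight x)⁻¹ • (h : ℝ → 𝕜) x) 2 weightedMeasure := by
  have hm : AEStronglyMeasurable (fun x => (weight x)⁻¹ • (h : ℝ → 𝕜) x) baseMeasure :=
    measurable_weight.inv.aestronglyMeasurable.smul (Lp.aestronglyMeasurable h)
  refine ⟨hm.mono_ac weightedMeasure_absolutelyContinuous, ?_⟩
  have hh := Lp.eLpNorm_lt_top h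
  rw [eLpNorm_lt_top_iff_lintegral_rpow_enorm_lt_top (by norm_num) (by norm_num)] at hh ⊢
  rw [weightedMeasure, lintegral_withDensity_eq_lintegral_mul_non_measurable _
    measurable_weight.ennreal_ofReal (ae_of_all _ fun _ => ENNReal.ofReal_lt_top)]
  refine lt_of_le_of_lt (lintegral_mono_ae ?_) hh
  filter_upwards [ae_one_le_weight] with x hx
  have h0 : 0 < weight x := by linarith
  simp only [Pi.mul_apply, ENNReal.toReal_ofNat, ENNReal.rpow_ofNat]
  rw [enorm_smul, mul_pow, ← mul_assoc, Real.enorm_of_nonneg (by positivity),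
    ← ENNReal.ofReal_pow (by positivity), ← ENNReal.ofReal_mul h0.le]
  refine mul_le_of_le_one_left' ?_
  rw [ENNReal.ofReal_le_one]
  have : weight x * (weight x)⁻¹ ^ 2 = (weight x)⁻¹ := by field_simp
  rw [this]
  exact inv_le_one_of_one_le₀ hx

/-- If `h` is orthogonal to the range, testing with `w⁻¹h` gives `∫ w⁻¹|h|² = 0`. -/
theorem inclusion_denseRange : DenseRange (spaceInclusion 𝕜) := by
  have key : (spaceInclusion 𝕜).range.topologicalClosure = ⊤ := by
    rw [Submodule.topologicalClosure_eq_top_iff, Submodule.eq_bot_iff]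
    intro h hh
    have h0 : inner 𝕜 (spaceInclusion 𝕜 ((memLp_inv_weight_smul h).toLp _)) h = 0 :=
      (Submodule.mem_orthogonal _ _).1 hh _ ⟨_, rfl⟩
    have hae : ∀ᵐ x ∂baseMeasure,
        (inner 𝕜 ((spaceInclusion 𝕜 ((memLp_inv_weight_smul h).toLp _) : ℝ → 𝕜) x) (h x) : 𝕜)
          = (((weight x)⁻¹ * ‖h x‖ ^ 2 : ℝ) : 𝕜) := by
      filter_upwards [inclusion_ae_eq ((memLp_inv_weight_smul h).toLp _),
        baseMeasure_absolutelyContinuous.ae_le (memLp_inv_weight_smul h).coeFn_toLp] with x h1 h2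
      rw [h1, h2, RCLike.real_smul_eq_coe_smul (K := 𝕜), inner_smul_left, RCLike.conj_ofReal,
        inner_self_eq_norm_sq_to_K]
      push_cast
      rfl
    have hint : Integrable (fun x => (weight x)⁻¹ * ‖h x‖ ^ 2) baseMeasure := by
      have := ((L2.integrable_inner (𝕜 := 𝕜)
        (spaceInclusion 𝕜 ((memLp_inv_weight_smul h).toLp _)) h).congr hae).re
      simpa only [RCLike.ofReal_re] using this
    rw [L2.inner_def, integral_congr_ae hae, integral_ofReal, RCLike.ofReal_eq_zero,
      integral_eq_zero_iff_of_nonneg_ae _ hint] at h0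
    · refine Lp.ext ?_
      filter_upwards [h0, ae_one_le_weight, Lp.coeFn_zero 𝕜 2 baseMeasure] with x h1 h2 h3
      rw [h3]
      have : weight x ≠ 0 := by linarith
      simpa [this] using h1
    · filter_upwards [ae_one_le_weight] with x hx
      have : 0 < weight x := by linarith
      simp only [Pi.zero_apply]
      positivity
  intro x
  have hx : x ∈ (spaceInclusion 𝕜).range.topologicalClosure := key ▸ Submodule.mem_top
  exact hx

variable (𝕜) in
/-- The indicator of a band, normalized in `V`. -/
def bandVector (n : ℕ) : SpaceV 𝕜 :=
  (((√(weightedMeasure.real (band n)))⁻¹ : ℝ) : 𝕜) •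
    indicatorConstLp 2 (measurableSet_band n) (weightedMeasure_band_ne_top n) (1 : 𝕜)

theorem norm_bandVector (n : ℕ) : ‖bandVector 𝕜 n‖ = 1 := by
  have := weightedMeasure_real_band_pos n
  rw [bandVector, norm_smul, norm_indicatorConstLp (by norm_num) (by norm_num),
    RCLike.norm_ofReal, abs_of_pos (by positivity), norm_one, one_mul, ENNReal.toReal_ofNat,
    ← Real.sqrt_eq_rpow]
  field_simp

theorem inclusion_bandVector (n : ℕ) : spaceInclusion 𝕜 (bandVector 𝕜 n) =
    (((√(weightedMeasure.real (band n)))⁻¹ : ℝ) : 𝕜) •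
      indicatorConstLp 2 (measurableSet_band n) (baseMeasure_band_ne_top n) (1 : 𝕜) := by
  rw [bandVector, map_smul]
  congr 1
  refine Lp.ext ?_
  filter_upwards [inclusion_ae_eq (indicatorConstLp 2 (measurableSet_band n)
    (weightedMeasure_band_ne_top n) (1 : 𝕜)), baseMeasure_absolutelyContinuous.ae_le
      (indicatorConstLp_coeFn (p := 2) (hs := measurableSet_band n)
        (hμs := weightedMeasure_band_ne_top n) (c := (1 : 𝕜))),
    indicatorConstLp_coeFn (p := 2) (hs := measurableSet_band n)
        (hμs := baseMeasure_band_ne_top n) (c := (1 : 𝕜))] with x h1 h2 h3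
  rw [h1, h2, h3]

theorem norm_sq_inclusion_bandVector (n : ℕ) : ‖spaceInclusion 𝕜 (bandVector 𝕜 n)‖ ^ 2
    = baseMeasure.real (band n) / weightedMeasure.real (band n) := by
  have h1 := weightedMeasure_real_band_pos n
  have h2 := baseMeasure_real_band_pos n
  rw [inclusion_bandVector, norm_smul, norm_indicatorConstLp (by norm_num) (by norm_num),
    RCLike.norm_ofReal, abs_of_pos (by positivity), norm_one, one_mul, ENNReal.toReal_ofNat,
    ← Real.sqrt_eq_rpow, mul_pow, inv_pow, Real.sq_sqrt h1.le, Real.sq_sqrt h2.le]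
  ring

theorem inner_inclusion_bandVector {n m : ℕ} (h : n ≠ m) :
    inner 𝕜 (spaceInclusion 𝕜 (bandVector 𝕜 n)) (spaceInclusion 𝕜 (bandVector 𝕜 m)) = 0 := by
  rw [inclusion_bandVector, inclusion_bandVector, inner_smul_left, inner_smul_right,
    L2.inner_indicatorConstLp_one]
  have : ∫ x in band n, (indicatorConstLp 2 (measurableSet_band m)
      (baseMeasure_band_ne_top m) (1 : 𝕜) : ℝ → 𝕜) x ∂baseMeasure = 0 := by
    rw [setIntegral_indicatorConstLp (measurableSet_band n), (disjoint_band h.symm).inter_eq]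
    simp
  rw [this, mul_zero, mul_zero]

/-- On the band `w ≥ 4ⁿ⁺¹`, so replacing `dx` by `w dx` gains that factor; Cauchy–Schwarz then costs
`√W`, which the normalization cancels. -/
theorem norm_inner_inclusion_bandVector_le (n : ℕ) (y : SpaceV 𝕜) :
    4 ^ (n + 1) * ‖inner 𝕜 (spaceInclusion 𝕜 (bandVector 𝕜 n)) (spaceInclusion 𝕜 y)‖ ≤ ‖y‖ := by
  have hW := weightedMeasure_real_band_pos n
  set W := weightedMeasure.real (band n) with hWdef
  have h1 : ‖∫ x in band n, (spaceInclusion 𝕜 y : ℝ → 𝕜) x ∂baseMeasure‖ₑ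
      ≤ ∫⁻ x in band n, ‖(y : ℝ → 𝕜) x‖ₑ ∂baseMeasure := by
    refine (enorm_integral_le_lintegral_enorm _).trans (le_of_eq ?_)
    refine lintegral_congr_ae ?_
    filter_upwards [ae_restrict_of_ae (inclusion_ae_eq y)] with x hx
    rw [hx]
  have h2 : ∫⁻ x in band n, ‖(y : ℝ → 𝕜) x‖ₑ ∂weightedMeasure
      ≤ ‖y‖ₑ * ENNReal.ofReal (√W) := by
    have := eLpNorm_le_eLpNorm_mul_rpow_measure_univ (p := 1) (q := 2)
      (μ := weightedMeasure.restrict (band n)) (by norm_num)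
      ((Lp.aestronglyMeasurable y).restrict)
    rw [eLpNorm_one_eq_lintegral_enorm, Measure.restrict_apply_univ] at this
    refine this.trans ?_
    gcongr
    · rw [Lp.enorm_def]
      exact eLpNorm_mono_measure _ Measure.restrict_le_self
    · rw [Real.sqrt_eq_rpow, ← ENNReal.ofReal_rpow_of_pos hW, hWdef,
        ofReal_measureReal (weightedMeasure_band_ne_top n)]
      norm_num
  have h3 : ENNReal.ofReal (4 ^ (n + 1)) *
      ‖∫ x in band n, (spaceInclusion 𝕜 y : ℝ → 𝕜) x ∂baseMeasure‖ₑ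
      ≤ ‖y‖ₑ * ENNReal.ofReal (√W) :=
    (mul_le_mul_right h1 _).trans ((lintegral_band_le n _).trans h2)
  have h4 : 4 ^ (n + 1) * ‖∫ x in band n, (spaceInclusion 𝕜 y : ℝ → 𝕜) x ∂baseMeasure‖
      ≤ ‖y‖ * √W := by
    rw [← ofReal_norm, ← ofReal_norm, ← ENNReal.ofReal_mul (by positivity),
      ← ENNReal.ofReal_mul (by positivity), ENNReal.ofReal_le_ofReal_iff (by positivity)] at h3
    exact h3
  rw [inclusion_bandVector, inner_smul_left, L2.inner_indicatorConstLp_one, RCLike.conj_ofReal,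
    norm_mul, RCLike.norm_ofReal, abs_of_pos (by positivity), ← hWdef, mul_left_comm,
    inv_mul_le_iff₀ (by positivity), mul_comm (√W)]
  exact h4

theorem adjoint_inclusion_bandVector_ne_zero (n : ℕ) :
    ContinuousLinearMap.adjoint (spaceInclusion 𝕜) (spaceInclusion 𝕜 (bandVector 𝕜 n)) ≠ 0 := by
  intro h
  have h1 : inner 𝕜 (spaceInclusion 𝕜 (bandVector 𝕜 n)) (spaceInclusion 𝕜 (bandVector 𝕜 n)) = 0 := by
    rw [← ContinuousLinearMap.adjoint_inner_left, h, inner_zero_left]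
  have h2 := norm_sq_inclusion_bandVector (𝕜 := 𝕜) n
  rw [inner_self_eq_zero.1 h1, norm_zero] at h2
  have h3 := div_pos (baseMeasure_real_band_pos n) (weightedMeasure_real_band_pos n)
  rw [← h2] at h3
  norm_num at h3

theorem norm_adjoint_inclusion_bandVector_le (n : ℕ) : 4 ^ (n + 1) *
    ‖ContinuousLinearMap.adjoint (spaceInclusion 𝕜) (spaceInclusion 𝕜 (bandVector 𝕜 n))‖ ≤ 1 := by
  set z := ContinuousLinearMap.adjoint (spaceInclusion 𝕜) (spaceInclusion 𝕜 (bandVector 𝕜 n))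
  -- Testing with `z` itself gives `4ⁿ⁺¹‖z‖² ≤ ‖z‖`.
  have h := norm_inner_inclusion_bandVector_le n z
  rw [← ContinuousLinearMap.adjoint_inner_left, inner_self_eq_norm_sq_to_K, norm_pow,
    RCLike.norm_ofReal, abs_norm, sq, ← mul_assoc] at h
  have hz : 0 < ‖z‖ := norm_pos_iff.2 (adjoint_inclusion_bandVector_ne_zero n)
  exact le_of_mul_le_mul_right (by rwa [one_mul]) hz

/-- Band 0 is reserved for `h₀`; the resulting shift gives `L = 16`. The constant `1/4` reflects
that `w` varies by a factor 4 on a band. -/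
theorem isLacunaryFamily_bandVector : ∃ h₀ : SpaceH 𝕜,
    IsLacunaryFamily (spaceInclusion 𝕜) 16 (1 / 4) h₀ fun n => bandVector 𝕜 (n + 1) := by
  have h0 := norm_pos_iff.2 (adjoint_inclusion_bandVector_ne_zero (𝕜 := 𝕜) 0)
  refine ⟨((‖ContinuousLinearMap.adjoint (spaceInclusion 𝕜)
    (spaceInclusion 𝕜 (bandVector 𝕜 0))‖⁻¹ : ℝ) : 𝕜) • spaceInclusion 𝕜 (bandVector 𝕜 0), ?_⟩
  have hpow : ∀ n : ℕ, (16 : ℝ) * 4 ^ n = 4 ^ (n + 1 + 1) := fun n => by ring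
  exact
    { one_le_L := by norm_num
      c_pos := by norm_num
      norm_adjoint := by
        rw [map_smul, norm_smul, RCLike.norm_ofReal, abs_of_pos (by positivity)]
        exact inv_mul_cancel₀ h0.ne'
      norm_le := fun n => (norm_bandVector _).le
      orthogonal := fun n m h => inner_inclusion_bandVector (by omega)
      orthogonal_zero := fun n => by
        rw [inner_smul_left, inner_inclusion_bandVector (by omega), mul_zero]
      lower := fun n => by
        rw [norm_sq_inclusion_bandVector, hpow, le_div_iff₀ (weightedMeasure_real_band_pos _),
          div_mul_eq_mul_div, div_le_iff₀ (by positivity)]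
        have := weightedMeasure_real_band_le (n + 1)
        rw [pow_succ _ (n + 1 + 1)] at this
        linarith
      upper := fun n => by
        rw [hpow]
        exact norm_adjoint_inclusion_bandVector_le (n + 1) }

end Embedding

end

theorem mainTheorem2 (𝕜 : Type) [RCLike 𝕜] (p q : ℝ≥0∞) (hp : 1 ≤ p) (hq : 2 < q)
    (T : ℝ) (hT : 0 < T) :
    ∃ j : SpaceV 𝕜 →L[𝕜] SpaceH 𝕜,
      (∀ v : SpaceV 𝕜, ∀ᵐ x ∂baseMeasure, (j v : ℝ → 𝕜) x = (v : ℝ → 𝕜) x) ∧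
      IsGelfandEmbedding j ∧
      ∃ 𝒜 : ℝ → SpaceV 𝕜 →L[𝕜] Antidual 𝕜 (SpaceV 𝕜),
        IsNonautonomousForm T 𝒜 ∧ IsCoerciveForm T 𝒜 ∧ IsSymmetricForm T 𝒜 ∧
        MemBesov T (1 / 2) p q 𝒜 ∧ ¬ HasMaximalRegularity j T 𝒜 := by
  obtain ⟨h₀, hE⟩ := isLacunaryFamily_bandVector (𝕜 := 𝕜)
  exact ⟨spaceInclusion 𝕜, inclusion_ae_eq, ⟨inclusion_injective, inclusion_denseRange⟩,
    lacunaryForm (spaceInclusion 𝕜) 16 h₀ fun n => bandVector 𝕜 (n + 1),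
    hE.isNonautonomousForm T, hE.isCoerciveForm T, IsLacunaryFamily.isSymmetricForm T,
    hE.memBesov hT p hq, hE.not_hasMaximalRegularity hT⟩
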